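/- **Setting.** Let $X$ be a (real) Banach space, $T>0$, $p\ge 1$ an integer, $F:[0,T]\times X\to X$ of class $C^{2p+2}$, and let $u\in C^{2p+3}([0,T],X)$ solve $u'(t)=F(t,u(t))$ on $[0,T]$, $u(0)=u_0$. For a step $k>0$ put $t_n=nk$ and $t_{n+1/2}=(n+\tfrac12)k$, and for a grid sequence $v=\{v^n\}$ put $$D_+v^n=\frac{v^{n+1}-v^n}{k},\quad D_-v^n=\frac{v^n-v^{n-1}}{k},\quad Dv^{n+1/2}=\frac{v^{n+1}-v^n}{k},\quad Ev^{n+1/2}=\frac{v^{n+1}+v^n}{2}.$$ Let $c_2,c_3,c_4,\dots$ be the coefficients of the central difference expansions $$f'(t_{n+1/2})\simeq Df(t_{n+1/2})-\sum_{i\ge1}c_{2i+1}k^{2i}D(D_+D_-)^if(t_{n+1/2}),\qquad f(t_{n+1/2})\simeq Ef(t_{n+1/2})-\sum_{i\ge1}c_{2i}k^{2i}(D_+D_-)^iEf(t_{n+1/2}),$$ namely $c_{2i}=\dfrac{d_{i,2i}}{2\,(2i)!}$ and $c_{2i+1}=\dfrac{d_{i,2i+1}}{(2i+1)!}$, where $d_{1,m}=2^{1-m}$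 for all $m\ge 2$ and, for $q\ge1$, and for odd, respectively even, $m\ge 2q+1$, $$d_{q+1,m}=d_{q,m}-\frac{d_{q,2q+1}}{(2q+1)!}\sum_{l=0}^{2q+1}(-1)^l\binom{2q+1}{l}\bigl(q-l+\tfrac12\bigr)^m\quad(m\text{ odd}),$$ $$d_{q+1,m}=d_{q,m}-\frac{d_{q,2q}}{2\,(2q)!}\sum_{l=0}^{2q}(-1)^l\binom{2q}{l}\Bigl[\bigl(q-l+\tfrac12\bigr)^m+\bigl(q-l-\tfrac12\bigr)^m\Bigr]\quad(m\text{ even})$$ (so $c_2=\tfrac18$, $c_3=\tfrac1{24}$, $c_4=-\tfrac3{128}$, $c_5=-\tfrac3{640}$, …). Consider an arbitrary family of uniform grids, each with a step $k>0$ and with integers $N,L$ such that $N+j\le L$ and $Lk\le T$. On each grid the sequence to be corrected, $\{u^{2j,n}\}$, has the indices $0\le n\le L$, and the corrected sequence $\{u^{2j+2,n}\}$ has the indices $0\le n\le N$ (for instance $Lk=T$ and $N=L-j$). All constants below are independent of $n$ and of the grid, and the estimates are meant for all sufficiently small $k$. A sequence $\{v^n\}_{0\le n\le M}$ approximates $u$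 with order $q$ of accuracy if $\|v^n-u(t_n)\|\le Ck^q$ for $0\le n\le M$. The sequence $\{u^{2j,n}\}$ satisfies the *deferred correction condition (DCC)* for the trapezoidal rule if it approximates $u$ with order $2j$ of accuracy and $$\|D(D_+D_-)(u^{2j,n+1/2}-u(t_{n+1/2}))\|+\|D_+D_-(u^{2j,n+1}-u(t_{n+1}))\|\le Ck^{2j},\qquad 1\le n\le L-2 .$$ **Theorem.** Let $1\le j\le p$ and let $\{u^{2j,n}\}$ satisfy (DCC) for the trapezoidal rule. Let $\{u^{2j+2,n}\}$ satisfy the scheme DC($2j+2$): $u^{2j+2,0}=u_0$ and, for $j\le n\le N-1$, $$\frac{u^{2j+2,n+1}-u^{2j+2,n}}{k}-\sum_{i=1}^jc_{2i+1}k^{2i}D(D_+D_-)^iu^{2j,n+1/2}=F\Bigl(t_{n+1/2},\ \frac{u^{2j+2,n+1}+u^{2j+2,n}}{2}-\sum_{i=1}^jc_{2i}k^{2i}(D_+D_-)^iEu^{2j,n+1/2}\Bigr),$$ with starting values such that $\|u^{2j+2,n}-u(t_n)\|\le Ck^{2j+2}$ for $1\le n\le j$ ($n\le N$). Suppose that one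 of the following holds: (i) $F$ is $\mu$-Lipschitz in $x$, with $\mu$ independent of $t\in[0,T]$; (ii) $X$ is a Hilbert space and $(F(t,x)-F(t,y),x-y)\le0$ for all $t\in[0,T]$ and $x,y\in X$; (iii) $X$ is finite dimensional and $\|u^{2j+2,n}-u(t_n)\|\le M$ for $0\le n\le N$, with $M$ independent of $n$ and of the grid; (iv) $\{u^{2j+2,n}\}$ converges to $u$, i.e. $\max_{0\le n\le N}\|u^{2j+2,n}-u(t_n)\|\to0$ as $k\to0$, uniformly over the family. Then $\{u^{2j+2,n}\}$ approximates $u$ with order $2j+2$ of accuracy: there are $C$ and $k_0>0$ with $\|u^{2j+2,n}-u(t_n)\|\le Ck^{2j+2}$ for $0\le n\le N$ on every grid of the family with $k\le k_0$. -/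

import Mathlib

open Set

noncomputable section

namespace DeferredCorrection

/-! ### Coefficients of the central difference expansions -/

/-- The numbers `d_{q,m}` for odd `m`, obtained by eliminating successively the odd derivatives
from the Taylor expansion of `f (t + k) - f t` about `t + k / 2`:
`d_{1,m} = 2 ^ (1 - m)` and
`d_{q+1,m} = d_{q,m} - d_{q,2q+1} / (2q+1)! * ∑_l (-1)^l (2q+1 choose l) (q - l + 1/2)^m`.
(The value at `q = 0` is not used.) -/
def dOdd : ℕ → ℕ → ℝ
  | 0, _ => 0
  | 1, m => 2 / 2 ^ m
  | q + 2, m => dOdd (q + 1) m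
      - dOdd (q + 1) (2 * (q + 1) + 1) / (Nat.factorial (2 * (q + 1) + 1) : ℝ)
        * ∑ l ∈ Finset.range (2 * (q + 1) + 2),
            (-1 : ℝ) ^ l * (Nat.choose (2 * (q + 1) + 1) l : ℝ)
              * (((q + 1 : ℕ) : ℝ) - (l : ℝ) + 1 / 2) ^ m

/-- The numbers `d_{q,m}` for even `m`, obtained by eliminating successively the even derivatives
from the Taylor expansion of `f (t + k) + f t` about `t + k / 2`:
`d_{1,m} = 2 ^ (1 - m)` and `d_{q+1,m} = d_{q,m} - d_{q,2q} / (2 (2q)!)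
* ∑_l (-1)^l (2q choose l) ((q - l + 1/2)^m + (q - l - 1/2)^m)`.
(The value at `q = 0` is not used.) -/
def dEven : ℕ → ℕ → ℝ
  | 0, _ => 0
  | 1, m => 2 / 2 ^ m
  | q + 2, m => dEven (q + 1) m
      - dEven (q + 1) (2 * (q + 1)) / (2 * (Nat.factorial (2 * (q + 1)) : ℝ))
        * ∑ l ∈ Finset.range (2 * (q + 1) + 1),
            (-1 : ℝ) ^ l * (Nat.choose (2 * (q + 1)) l : ℝ)
              * ((((q + 1 : ℕ) : ℝ) - (l : ℝ) + 1 / 2) ^ m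
                + (((q + 1 : ℕ) : ℝ) - (l : ℝ) - 1 / 2) ^ m)

/-- The coefficient `c_{2i+1}`: `1/24, -3/640, 5/7168, …` for `i = 1, 2, 3, …`. -/
def cOdd (i : ℕ) : ℝ := dOdd i (2 * i + 1) / (Nat.factorial (2 * i + 1) : ℝ)

/-- The coefficient `c_{2i}`: `1/8, -3/128, 5/1024, …` for `i = 1, 2, 3, …`. -/
def cEven (i : ℕ) : ℝ := dEven i (2 * i) / (2 * (Nat.factorial (2 * i) : ℝ))

/-! ### Difference operators on grid functions

A grid function is a map `v : ℤ → X`, where `v n` is the value at `t_n = n k`. -/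

section Operators

variable {X : Type*} [NormedAddCommGroup X] [NormedSpace ℝ X]

/-- Forward difference `D₊ v` at `t_n`. -/
def dPlus (k : ℝ) (v : ℤ → X) (n : ℤ) : X := k⁻¹ • (v (n + 1) - v n)

/-- Backward difference `D₋ v` at `t_n`. -/
def dMinus (k : ℝ) (v : ℤ → X) (n : ℤ) : X := k⁻¹ • (v n - v (n - 1))

/-- The power `(D₊ D₋) ^ m v`. -/
def dPM (k : ℝ) (m : ℕ) (v : ℤ → X) : ℤ → X := (fun w => dPlus k (dMinus k w))^[m] v

/-- Centred difference `D v` at the midpoint `t_{n+1/2}`. -/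
def dMid (k : ℝ) (v : ℤ → X) (n : ℤ) : X := k⁻¹ • (v (n + 1) - v n)

/-- Average `E v` at the midpoint `t_{n+1/2}`. -/
def avgMid (v : ℤ → X) (n : ℤ) : X := (2⁻¹ : ℝ) • (v (n + 1) + v n)

/-- The error `v n - u (t_n)` of a grid function with respect to `u`. -/
def gridError (u : ℝ → X) (k : ℝ) (v : ℤ → X) (n : ℤ) : X := v n - u ((n : ℝ) * k)

/-! ### Order of accuracy and the deferred correction condition

A family of uniform grids is indexed by a type `ι`; the grid `g : ι` has step `k g` and points
`t_n = n (k g)`, `n = 0, …, N g`, and `v g` is a grid function on it. All the constants are uniform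
over the family. -/

/-- The family `v` approximates `u` at `t_0, …, t_{N g}` with order `q`: the errors are at most
`C k ^ q`, for all sufficiently small steps `k`, with `C` independent of `n` and of the grid. -/
def HasOrder {ι : Type*} (u : ℝ → X) (k : ι → ℝ) (N : ι → ℕ) (v : ι → ℤ → X) (q : ℕ) : Prop :=
  ∃ C k₀ : ℝ, 0 < k₀ ∧ ∀ g, k g ≤ k₀ → ∀ n : ℤ, 0 ≤ n → n ≤ N g →
    ‖gridError u (k g) (v g) n‖ ≤ C * k g ^ q

/-- The family `v` converges to `u`, uniformly on the grid points, as the step tends to zero. -/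
def ConvergesTo {ι : Type*} (u : ℝ → X) (k : ι → ℝ) (N : ι → ℕ) (v : ι → ℤ → X) : Prop :=
  ∀ ε : ℝ, 0 < ε → ∃ k₀ : ℝ, 0 < k₀ ∧ ∀ g, k g ≤ k₀ → ∀ n : ℤ, 0 ≤ n → n ≤ N g →
    ‖gridError u (k g) (v g) n‖ ≤ ε

/-- Deferred correction condition for the trapezoidal rule, for a family `v` of grid functions
with index range `0, …, N g`: order `2 j` of accuracy, and
`‖D (D₊D₋) (v - u)(t_{n+1/2})‖ + ‖D₊D₋ (v - u)(t_{n+1})‖ ≤ C k ^ (2 j)` for `1 ≤ n ≤ N - 2`. -/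
def DCC {ι : Type*} (u : ℝ → X) (k : ι → ℝ) (N : ι → ℕ) (v : ι → ℤ → X) (j : ℕ) : Prop :=
  HasOrder u k N v (2 * j) ∧
  ∃ C k₀ : ℝ, 0 < k₀ ∧ ∀ g, k g ≤ k₀ → ∀ n : ℤ, 1 ≤ n → n + 2 ≤ N g →
    ‖dMid (k g) (dPM (k g) 1 (gridError u (k g) (v g))) n‖
      + ‖dPM (k g) 1 (gridError u (k g) (v g)) (n + 1)‖ ≤ C * k g ^ (2 * j)

/-- One step, from `t_n` to `t_{n+1}`, of the scheme `DC(2j+2)` with unknown `w`, corrected by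
means of `v`. -/
def DCStep (F : ℝ → X → X) (j : ℕ) (k : ℝ) (v w : ℤ → X) (n : ℤ) : Prop :=
  k⁻¹ • (w (n + 1) - w n)
      - ∑ i ∈ Finset.Icc 1 j, (cOdd i * k ^ (2 * i)) • dMid k (dPM k i v) n
    = F (((n : ℝ) + 1 / 2) * k)
        ((2⁻¹ : ℝ) • (w (n + 1) + w n)
          - ∑ i ∈ Finset.Icc 1 j, (cEven i * k ^ (2 * i)) • dPM k i (avgMid v) n)

/-- `u` solves `u' = F (t, u)` on `[0, T]` with `u 0 = u₀` (one-sided derivatives at the ends). -/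
def IsSolution (F : ℝ → X → X) (T : ℝ) (u₀ : X) (u : ℝ → X) : Prop :=
  (∀ t ∈ Icc 0 T, HasDerivWithinAt u (F t (u t)) (Icc 0 T) t) ∧ u 0 = u₀

end Operators

/-- The Banach space `X` is a Hilbert space (its norm and scalar multiplication come from a real
inner product) and `(F(t,x) - F(t,y), x - y) ≤ 0` for all `t ∈ [0, T]` and all `x, y`. -/
def HilbertMonotone {X : Type*} [NormedAddCommGroup X] [inst : NormedSpace ℝ X]
    (F : ℝ → X → X) (T : ℝ) : Prop :=
  ∃ H : InnerProductSpace ℝ X, H.toNormedSpace = inst ∧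
    ∀ t ∈ Icc 0 T, ∀ x y : X, inner ℝ (F t x - F t y) (x - y) ≤ 0

end DeferredCorrection

end

noncomputable section

open Finset

namespace DeferredCorrection

/-! ### Differences of monomials and moments of the central difference formulas -/

/-! Let `e` be the error of the corrected sequence. Subtracting the differential equation at the
midpoint from the scheme gives `D e = F(t, u + τ + E e) - F(t, u) + σ` (`exists_error_equation`).
The theorem then splits into consistency, that `σ` and `τ` are `O(k^(2j+2))`, and stability, that
such perturbations produce an error of the same size.

The perturbations have two sources. The first is the truncation error of the two difference formulas
on `u`. The recursions for `dOdd` and `dEven` compute residual moments: each new coefficient cancels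
the lowest moment not yet correct, and reflection symmetry takes care of the other parity. Hence the
formulas are exact in degree at most `2j+2` for the derivative and `2j+1` for the midpoint value
(`oddMoment_eq_ite`, `evenMoment_eq_ite`). A Taylor expansion at the midpoint, with a constant
uniform in the base point, does the rest. The second source is the correction operator applied to
the error of the lower-order sequence. Written in undivided differences it contains at least a
third, respectively a second, difference; (DCC) bounds these, any further undivided difference costs
only a factor 2, and a factor `k^2` remains (`exists_norm_corr_le`).

For stability, a one-step bound on the growth of the error norm feeds a discrete Gronwall inequality
(`hasOrder_of_step`). The one-step bound follows from a Lipschitz estimate for `F` at the points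
that occur: global in (i), on a bounded convex set in (iii), on a thin tube around the trajectory in
(iv). In (ii) the error equation is paired with `E e`: monotonicity removes the nonlinear term, and
only the perturbation `τ` needs the Lipschitz estimate in the tube. -/

/-- The `r`-th forward difference with unit step of the monomial `y ^ m`, at `x`. -/
def powDiff (r m : ℕ) (x : ℝ) : ℝ := (fwdDiff (1 : ℝ))^[r] (fun y : ℝ => y ^ m) x

lemma powDiff_eq_sum (r m : ℕ) (x : ℝ) :
    powDiff r m x = ∑ l ∈ range (r + 1), (-1 : ℝ) ^ (r - l) * (r.choose l : ℝ) * (x + l) ^ m := by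
  rw [powDiff, fwdDiff_iter_eq_sum_shift]
  refine Finset.sum_congr rfl fun l _ => ?_
  simp [zsmul_eq_mul]

lemma powDiff_eq_sum_reflect (r m : ℕ) (x : ℝ) :
    powDiff r m x = ∑ l ∈ range (r + 1), (-1 : ℝ) ^ l * (r.choose l : ℝ) * (x + r - l) ^ m := by
  rw [powDiff_eq_sum, ← Finset.sum_range_reflect]
  refine Finset.sum_congr rfl fun l hl => ?_
  have hl' : l ≤ r := by have := Finset.mem_range.1 hl; omega
  have h1 : r + 1 - 1 - l = r - l := by omega
  rw [h1, Nat.choose_symm hl', Nat.sub_sub_self hl', Nat.cast_sub hl', add_sub_assoc]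

/-- The reflection `y ↦ -y` maps the nodes `x, …, x + r` to those starting at `-x - r`; reversing
their order contributes `(-1)^r` and the monomial `(-1)^m`. -/
lemma powDiff_reflect (r m : ℕ) (x : ℝ) :
    powDiff r m (-x - r) = (-1) ^ (r + m) * powDiff r m x := by
  rw [powDiff_eq_sum_reflect, powDiff_eq_sum, Finset.mul_sum]
  refine Finset.sum_congr rfl fun l hl => ?_
  have hl' : l ≤ r := by have := Finset.mem_range.1 hl; omega
  obtain ⟨s, rfl⟩ := Nat.exists_eq_add_of_le hl'
  have h1 : -x - ((l + s : ℕ) : ℝ) + ((l + s : ℕ) : ℝ) - l = (-1) * (x + l) := by ring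
  have h2 : ((-1 : ℝ) ^ s) * (-1) ^ s = 1 := by rw [← mul_pow]; norm_num
  rw [h1, mul_pow, Nat.add_sub_cancel_left, pow_add, pow_add]
  linear_combination (-((-1 : ℝ) ^ l * (-1) ^ m * ((l + s).choose l : ℝ) * (x + l) ^ m)) * h2

lemma powDiff_of_lt {r m : ℕ} (h : m < r) (x : ℝ) : powDiff r m x = 0 := by
  rw [powDiff, fwdDiff_iter_pow_eq_zero_of_lt h]; rfl

lemma powDiff_self (r : ℕ) (x : ℝ) : powDiff r r x = (r.factorial : ℝ) := by
  rw [powDiff, fwdDiff_iter_eq_factorial]; rfl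

/-- The value on `x ^ m` (with unit step, at `0`) of the difference formula for the derivative
with `j` correction terms. -/
def oddMoment (j m : ℕ) : ℝ :=
  powDiff 1 m (-(1 / 2)) - ∑ i ∈ Finset.Icc 1 j, cOdd i * powDiff (2 * i + 1) m (-(i : ℝ) - 1 / 2)

/-- The value on `x ^ m` (with unit step, at `0`) of the difference formula for the midpoint value
with `j` correction terms. -/
def evenMoment (j m : ℕ) : ℝ :=
  2⁻¹ * (powDiff 0 m (1 / 2) + powDiff 0 m (-(1 / 2))) - ∑ i ∈ Finset.Icc 1 j, cEven i *
    (2⁻¹ * (powDiff (2 * i) m (-(i : ℝ) + 1 / 2) + powDiff (2 * i) m (-(i : ℝ) - 1 / 2)))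

lemma oddMoment_succ (j m : ℕ) : oddMoment (j + 1) m = oddMoment j m -
    cOdd (j + 1) * powDiff (2 * (j + 1) + 1) m (-((j + 1 : ℕ) : ℝ) - 1 / 2) := by
  rw [oddMoment, oddMoment, Finset.sum_Icc_succ_top (by omega)]; ring

lemma evenMoment_succ (j m : ℕ) : evenMoment (j + 1) m = evenMoment j m -
    cEven (j + 1) * (2⁻¹ * (powDiff (2 * (j + 1)) m (-((j + 1 : ℕ) : ℝ) + 1 / 2) +
      powDiff (2 * (j + 1)) m (-((j + 1 : ℕ) : ℝ) - 1 / 2))) := by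
  rw [evenMoment, evenMoment, Finset.sum_Icc_succ_top (by omega)]; ring

/-- The defining recursion is the effect on the `m`-th moment of one more correction term. Parity
enters only at the start, where `(1/2)^m - (-1/2)^m = 2/2^m`. The index is shifted because `dOdd 1`
belongs to the formula without corrections. -/
lemma dOdd_eq_oddMoment (j : ℕ) {m : ℕ} (hm : Odd m) : dOdd (j + 1) m = oddMoment j m := by
  induction j with
  | zero =>
    simp only [dOdd, oddMoment, powDiff_eq_sum]
    simp [Finset.sum_range_succ, hm.neg_pow]
    ring_nf
    norm_num
    ring
  | succ q ih =>
    rw [dOdd, oddMoment_succ, ih, cOdd, powDiff_eq_sum_reflect]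
    congr 2
    refine Finset.sum_congr rfl fun l _ => ?_
    congr 2
    push_cast; ring

/-- The factor 2 arises because `dEven` expands the sum of the two values while the moment uses
their average. -/
lemma dEven_eq_evenMoment (j : ℕ) {m : ℕ} (hm : Even m) :
    dEven (j + 1) m = 2 * evenMoment j m := by
  induction j with
  | zero =>
    simp only [dEven, evenMoment, powDiff_eq_sum]
    simp [hm.neg_pow]
    ring
  | succ q ih =>
    rw [dEven, evenMoment_succ, ih, cEven, ih.symm, powDiff_eq_sum_reflect, powDiff_eq_sum_reflect,
      ← Finset.sum_add_distrib, mul_sub, ← ih]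
    congr 1
    rw [mul_left_comm (2 : ℝ) _ (2⁻¹ * _), mul_inv_cancel_left₀ two_ne_zero]
    congr 1
    refine Finset.sum_congr rfl fun l _ => ?_
    rw [← mul_add]
    congr 3 <;> (push_cast; ring)

lemma oddMoment_of_even (j : ℕ) {m : ℕ} (hm : Even m) : oddMoment j m = 0 := by
  -- Each stencil is symmetric about `0`, so reflection fixes the difference and multiplies it by
  -- `-1`. The case `i = 0` is the leading term.
  have key : ∀ i : ℕ, powDiff (2 * i + 1) m (-(i : ℝ) - 1 / 2) = 0 := by
    intro i
    have h := powDiff_reflect (2 * i + 1) m (-(i : ℝ) - 1 / 2)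
    have h1 : -(-(i : ℝ) - 1 / 2) - ((2 * i + 1 : ℕ) : ℝ) = -(i : ℝ) - 1 / 2 := by
      push_cast; ring
    have h2 : Odd (2 * i + 1 + m) := by
      obtain ⟨s, rfl⟩ := hm
      exact ⟨i + s, by ring⟩
    rw [h1, h2.neg_one_pow] at h
    linarith
  have h0 := key 0
  norm_num at h0
  rw [oddMoment, Finset.sum_eq_zero fun i _ => by rw [key, mul_zero], h0, sub_zero]

lemma evenMoment_of_odd (j : ℕ) {m : ℕ} (hm : Odd m) : evenMoment j m = 0 := by
  -- Here reflection exchanges the two stencils of the average, with sign `-1`.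
  have key : ∀ i : ℕ, powDiff (2 * i) m (-(i : ℝ) + 1 / 2) +
      powDiff (2 * i) m (-(i : ℝ) - 1 / 2) = 0 := by
    intro i
    have h := powDiff_reflect (2 * i) m (-(i : ℝ) - 1 / 2)
    have h1 : -(-(i : ℝ) - 1 / 2) - ((2 * i : ℕ) : ℝ) = -(i : ℝ) + 1 / 2 := by
      push_cast; ring
    have h2 : Odd (2 * i + m) := by
      obtain ⟨s, rfl⟩ := hm
      exact ⟨i + s, by ring⟩
    rw [h1, h2.neg_one_pow] at h
    linarith
  have h0 := key 0
  norm_num at h0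
  rw [evenMoment, Finset.sum_eq_zero fun i _ => by rw [key, mul_zero, mul_zero]]
  norm_num
  exact h0

lemma oddMoment_eq_ite (j : ℕ) {m : ℕ} (hm : m ≤ 2 * j + 2) :
    oddMoment j m = if m = 1 then 1 else 0 := by
  rcases Nat.even_or_odd m with he | ho
  · rw [oddMoment_of_even j he, if_neg]
    rintro rfl; exact absurd he (by decide)
  · have hm' : m ≤ 2 * j + 1 := by
      obtain ⟨s, rfl⟩ := ho; omega
    clear hm
    induction j with
    | zero =>
      have : m = 1 := by obtain ⟨s, rfl⟩ := ho; omega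
      subst this
      simp [oddMoment, powDiff_self]
    | succ q ih =>
      rw [oddMoment_succ]
      -- The new difference annihilates all lower degrees, so the moments already correct are
      -- preserved; in its own degree it equals a factorial, and the coefficient is the residual
      -- moment divided by that factorial.
      rcases lt_or_eq_of_le hm' with h | h
      · rw [powDiff_of_lt h, mul_zero, sub_zero]
        exact ih (by obtain ⟨s, rfl⟩ := ho; omega)
      · rw [h, powDiff_self, cOdd, dOdd_eq_oddMoment q (h ▸ ho),
          div_mul_cancel₀ _ (Nat.cast_ne_zero.2 (Nat.factorial_ne_zero _)), sub_self, if_neg]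
        omega

lemma evenMoment_eq_ite (j : ℕ) {m : ℕ} (hm : m ≤ 2 * j + 1) :
    evenMoment j m = if m = 0 then 1 else 0 := by
  rcases Nat.even_or_odd m with he | ho
  · have hm' : m ≤ 2 * j := by
      obtain ⟨s, rfl⟩ := he; omega
    clear hm
    induction j with
    | zero =>
      have : m = 0 := by omega
      subst this
      norm_num [evenMoment, powDiff_self]
    | succ q ih =>
      rw [evenMoment_succ]
      rcases lt_or_eq_of_le hm' with h | h
      · rw [powDiff_of_lt h, powDiff_of_lt h, add_zero, mul_zero, mul_zero, sub_zero]
        exact ih (by obtain ⟨s, rfl⟩ := he; omega)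
      · rw [h, powDiff_self, powDiff_self, cEven, dEven_eq_evenMoment q (h ▸ he), if_neg (by omega)]
        have : ((2 * (q + 1)).factorial : ℝ) ≠ 0 := Nat.cast_ne_zero.2 (Nat.factorial_ne_zero _)
        field_simp
        ring
  · rw [evenMoment_of_odd j ho, if_neg]
    rintro rfl; exact absurd ho (by decide)

variable {X : Type*} [NormedAddCommGroup X] [NormedSpace ℝ X]

/-! ### The difference formulas in terms of iterated forward differences -/

/-- `D₊D₋` is `k⁻²` times the second forward difference shifted back by one. In this form the powers
of `k` in the correction terms cancel explicitly. -/
lemma dPM_eq_fwdDiff (k : ℝ) (i : ℕ) (v : ℤ → X) (n : ℤ) :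
    dPM k i v n = (k⁻¹) ^ (2 * i) • (fwdDiff (1 : ℤ))^[2 * i] v (n - i) := by
  induction i generalizing v n with
  | zero => simp [dPM]
  | succ i ih =>
    have h1 : (fun n => dPlus k (dMinus k v) n) =
        (k⁻¹) ^ 2 • fun n : ℤ => (fwdDiff (1 : ℤ))^[2] v (n + -1) := by
      funext n
      simp only [dPlus, dMinus, Pi.smul_apply, Function.iterate_succ, Function.iterate_zero,
        Function.comp, id, fwdDiff]
      have e1 : n + -1 + 1 = n := by ring
      have e2 : n + 1 - 1 = n := by ring
      rw [← smul_sub, smul_smul, ← sq, e1, e2, sub_eq_add_neg n 1]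
    have h2 : dPM k (i + 1) v n = dPM k i (fun n => dPlus k (dMinus k v) n) n := by
      simp only [dPM, Function.iterate_succ_apply]
    rw [h2, ih, h1, fwdDiff_iter_const_smul, Pi.smul_apply, fwdDiff_iter_comp_add, smul_smul,
      ← pow_add, ← Function.iterate_add_apply]
    have e : (n - i + -1 : ℤ) = n - (i + 1 : ℕ) := by push_cast; ring
    rw [e, mul_add_one]

-- Only the values on the stencil enter, which matters because errors are controlled on the grid
-- alone.
omit [NormedSpace ℝ X] in
lemma norm_fwdDiff_iter_le (r : ℕ) (v : ℤ → X) (a : ℤ) {B : ℝ}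
    (h : ∀ s : ℤ, a ≤ s → s ≤ a + r → ‖v s‖ ≤ B) :
    ‖(fwdDiff (1 : ℤ))^[r] v a‖ ≤ 2 ^ r * B := by
  induction r generalizing a with
  | zero => simpa using h a le_rfl (by simp)
  | succ r ih =>
    rw [Function.iterate_succ_apply', fwdDiff]
    have h1 := ih (a + 1) fun s hs hs' => h s (by omega) (by push_cast; omega)
    have h2 := ih a fun s hs hs' => h s (by omega) (by push_cast; omega)
    calc _ ≤ _ := norm_sub_le _ _
      _ ≤ 2 ^ r * B + 2 ^ r * B := add_le_add h1 h2
      _ = _ := by ring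

lemma fwdDiff_iter_int_comp (r : ℕ) (φ : ℝ → ℝ) (b : ℝ) (c : X) (a : ℤ) :
    (fwdDiff (1 : ℤ))^[r] (fun l : ℤ => φ (l - b) • c) a =
      (fwdDiff (1 : ℝ))^[r] φ (a - b) • c := by
  induction r generalizing φ with
  | zero => rfl
  | succ r ih =>
    rw [Function.iterate_succ_apply, Function.iterate_succ_apply, ← ih]
    have h : fwdDiff (1 : ℤ) (fun l : ℤ => φ (l - b) • c) =
        fun l : ℤ => fwdDiff (1 : ℝ) φ (l - b) • c := by
      funext l
      simp only [fwdDiff]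
      rw [← sub_smul]
      congr 3
      push_cast; ring
    rw [h]

/-- The correction terms of the difference formula for the derivative. -/
def oddCorr (k : ℝ) (j : ℕ) (v : ℤ → X) (n : ℤ) : X :=
  ∑ i ∈ Finset.Icc 1 j, (cOdd i * k ^ (2 * i)) • dMid k (dPM k i v) n

/-- The correction terms of the difference formula for the midpoint value. -/
def evenCorr (k : ℝ) (j : ℕ) (v : ℤ → X) (n : ℤ) : X :=
  ∑ i ∈ Finset.Icc 1 j, (cEven i * k ^ (2 * i)) • dPM k i (avgMid v) n

lemma oddCorr_eq {k : ℝ} (hk : k ≠ 0) (j : ℕ) (v : ℤ → X) (n : ℤ) :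
    oddCorr k j v n = ∑ i ∈ Finset.Icc 1 j,
      (cOdd i * k⁻¹) • (fwdDiff (1 : ℤ))^[2 * i + 1] v (n - i) := by
  refine Finset.sum_congr rfl fun i _ => ?_
  rw [dMid, dPM_eq_fwdDiff, dPM_eq_fwdDiff, ← smul_sub, smul_smul, smul_smul,
    Function.iterate_succ_apply', fwdDiff]
  congr 1
  · rw [inv_pow]; field_simp
  · rw [sub_add_eq_add_sub]

lemma evenCorr_eq {k : ℝ} (hk : k ≠ 0) (j : ℕ) (v : ℤ → X) (n : ℤ) :
    evenCorr k j v n = ∑ i ∈ Finset.Icc 1 j, (cEven i * 2⁻¹) •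
      ((fwdDiff (1 : ℤ))^[2 * i] v (n - i + 1) + (fwdDiff (1 : ℤ))^[2 * i] v (n - i)) := by
  refine Finset.sum_congr rfl fun i _ => ?_
  have h : avgMid v = (2⁻¹ : ℝ) • ((fun n => v (n + 1)) + v) := rfl
  rw [dPM_eq_fwdDiff, h, fwdDiff_iter_const_smul, fwdDiff_iter_add, Pi.smul_apply, Pi.add_apply,
    fwdDiff_iter_comp_add, smul_smul, smul_smul, inv_pow]
  congr 1
  field_simp

lemma dMid_add (k : ℝ) (v w : ℤ → X) (n : ℤ) : dMid k (v + w) n = dMid k v n + dMid k w n := by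
  simp only [dMid, Pi.add_apply, ← smul_add]
  congr 1; abel

lemma avgMid_add (v w : ℤ → X) (n : ℤ) : avgMid (v + w) n = avgMid v n + avgMid w n := by
  simp only [avgMid, Pi.add_apply, ← smul_add]
  congr 1; abel

lemma oddCorr_add {k : ℝ} (hk : k ≠ 0) (j : ℕ) (v w : ℤ → X) (n : ℤ) :
    oddCorr k j (v + w) n = oddCorr k j v n + oddCorr k j w n := by
  simp only [oddCorr_eq hk, fwdDiff_iter_add, Pi.add_apply, smul_add, Finset.sum_add_distrib]

lemma evenCorr_add {k : ℝ} (hk : k ≠ 0) (j : ℕ) (v w : ℤ → X) (n : ℤ) :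
    evenCorr k j (v + w) n = evenCorr k j v n + evenCorr k j w n := by
  rw [evenCorr_eq hk, evenCorr_eq hk, evenCorr_eq hk, ← Finset.sum_add_distrib]
  refine Finset.sum_congr rfl fun i _ => ?_
  rw [fwdDiff_iter_add, Pi.add_apply, Pi.add_apply, ← smul_add]
  congr 1; abel

/-! ### Exactness on polynomials -/

lemma fwdDiff_iter_monomial (r m : ℕ) (k b : ℝ) (c : X) (a : ℤ) :
    (fwdDiff (1 : ℤ))^[r] (fun l : ℤ => (l * k - b * k) ^ m • c) a =
      (k ^ m * powDiff r m (a - b)) • c := by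
  have h : (fun l : ℤ => ((l : ℝ) * k - b * k) ^ m • c) =
      fun l : ℤ => (fun y : ℝ => y ^ m) ((l : ℝ) - b) • (k ^ m • c) := by
    funext l
    rw [smul_smul, ← mul_pow, ← sub_mul]
  rw [h, fwdDiff_iter_int_comp r (fun y : ℝ => y ^ m), smul_smul, mul_comm]; rfl

lemma dMid_sub_oddCorr_monomial {k : ℝ} (hk : k ≠ 0) (j m : ℕ) (n : ℤ) (c : X) :
    dMid k (fun l : ℤ => (l * k - (n + 1 / 2) * k) ^ m • c) n
      - oddCorr k j (fun l : ℤ => (l * k - (n + 1 / 2) * k) ^ m • c) n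
      = (k⁻¹ * k ^ m * oddMoment j m) • c := by
  have h0 : dMid k (fun l : ℤ => (l * k - (n + 1 / 2) * k) ^ m • c) n =
      k⁻¹ • (fwdDiff (1 : ℤ))^[1] (fun l : ℤ => (l * k - (n + 1 / 2) * k) ^ m • c) n := rfl
  rw [h0, oddCorr_eq hk, oddMoment, fwdDiff_iter_monomial, mul_sub, sub_smul, smul_smul,
    Finset.mul_sum, Finset.sum_smul]
  congr 1
  · congr 1
    rw [mul_assoc]; congr 3; ring
  · refine Finset.sum_congr rfl fun i _ => ?_
    rw [fwdDiff_iter_monomial, smul_smul]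
    congr 1
    have : ((n - i : ℤ) : ℝ) - ((n : ℝ) + 1 / 2) = -(i : ℝ) - 1 / 2 := by push_cast; ring
    rw [this]; ring

lemma avgMid_sub_evenCorr_monomial {k : ℝ} (hk : k ≠ 0) (j m : ℕ) (n : ℤ) (c : X) :
    avgMid (fun l : ℤ => (l * k - (n + 1 / 2) * k) ^ m • c) n
      - evenCorr k j (fun l : ℤ => (l * k - (n + 1 / 2) * k) ^ m • c) n
      = (k ^ m * evenMoment j m) • c := by
  have h0 : avgMid (fun l : ℤ => (l * k - (n + 1 / 2) * k) ^ m • c) n =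
      (2⁻¹ : ℝ) • ((fwdDiff (1 : ℤ))^[0] (fun l : ℤ => (l * k - (n + 1 / 2) * k) ^ m • c) (n + 1)
        + (fwdDiff (1 : ℤ))^[0] (fun l : ℤ => (l * k - (n + 1 / 2) * k) ^ m • c) n) := rfl
  rw [h0, evenCorr_eq hk, evenMoment, fwdDiff_iter_monomial, fwdDiff_iter_monomial, mul_sub,
    sub_smul, ← add_smul, smul_smul, Finset.mul_sum, Finset.sum_smul]
  congr 1
  · have h1 : ((n + 1 : ℤ) : ℝ) - ((n : ℝ) + 1 / 2) = 1 / 2 := by push_cast; ring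
    have h2 : (n : ℝ) - ((n : ℝ) + 1 / 2) = -(1 / 2) := by ring
    rw [h1, h2]; congr 1; ring
  · refine Finset.sum_congr rfl fun i _ => ?_
    rw [fwdDiff_iter_monomial, fwdDiff_iter_monomial, ← add_smul, smul_smul]
    have h1 : ((n - i + 1 : ℤ) : ℝ) - ((n : ℝ) + 1 / 2) = -(i : ℝ) + 1 / 2 := by push_cast; ring
    have h2 : ((n - i : ℤ) : ℝ) - ((n : ℝ) + 1 / 2) = -(i : ℝ) - 1 / 2 := by push_cast; ring
    rw [h1, h2]; congr 1; ring

omit [NormedSpace ℝ X] in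
lemma fwdDiff_iter_sum {α : Type*} (s : Finset α) (f : α → ℤ → X) (r : ℕ) (a : ℤ) :
    (fwdDiff (1 : ℤ))^[r] (fun l => ∑ x ∈ s, f x l) a =
      ∑ x ∈ s, (fwdDiff (1 : ℤ))^[r] (f x) a := by
  have : (fun l => ∑ x ∈ s, f x l) = ∑ x ∈ s, f x := by funext l; simp
  rw [this, fwdDiff_iter_finsetSum, Finset.sum_apply]

lemma oddCorr_sum {k : ℝ} (hk : k ≠ 0) (j : ℕ) {α : Type*} (s : Finset α) (f : α → ℤ → X)
    (n : ℤ) : oddCorr k j (fun l => ∑ x ∈ s, f x l) n = ∑ x ∈ s, oddCorr k j (f x) n := by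
  simp only [oddCorr_eq hk, fwdDiff_iter_sum, Finset.smul_sum]
  exact Finset.sum_comm

lemma evenCorr_sum {k : ℝ} (hk : k ≠ 0) (j : ℕ) {α : Type*} (s : Finset α) (f : α → ℤ → X)
    (n : ℤ) : evenCorr k j (fun l => ∑ x ∈ s, f x l) n = ∑ x ∈ s, evenCorr k j (f x) n := by
  simp only [evenCorr_eq hk, fwdDiff_iter_sum, ← Finset.sum_add_distrib, Finset.smul_sum]
  exact Finset.sum_comm

/-- Degrees up to `2j+2` are allowed, one more than in the even formula; this compensates for the
division by `k` when the Taylor remainder is estimated. -/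
lemma dMid_sub_oddCorr_polynomial {k : ℝ} (hk : k ≠ 0) (j : ℕ) (n : ℤ) (c : ℕ → X) :
    dMid k (fun l : ℤ => ∑ m ∈ range (2 * j + 3), (l * k - (n + 1 / 2) * k) ^ m • c m) n
      - oddCorr k j
        (fun l : ℤ => ∑ m ∈ range (2 * j + 3), (l * k - (n + 1 / 2) * k) ^ m • c m) n = c 1 := by
  rw [oddCorr_sum hk, dMid, ← Finset.sum_sub_distrib, Finset.smul_sum, ← Finset.sum_sub_distrib,
    Finset.sum_eq_single 1]
  · have := dMid_sub_oddCorr_monomial hk j 1 n (c 1)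
    rw [oddMoment_eq_ite j (by omega), if_pos rfl, pow_one, inv_mul_cancel₀ hk, one_mul,
      one_smul] at this
    exact this
  · intro m hm hm1
    have := dMid_sub_oddCorr_monomial hk j m n (c m)
    rw [oddMoment_eq_ite j (by have := Finset.mem_range.1 hm; omega), if_neg hm1, mul_zero,
      zero_smul] at this
    exact this
  · intro h; exact absurd (Finset.mem_range.2 (by omega)) h

lemma avgMid_sub_evenCorr_polynomial {k : ℝ} (hk : k ≠ 0) (j : ℕ) (n : ℤ) (c : ℕ → X) :
    avgMid (fun l : ℤ => ∑ m ∈ range (2 * j + 2), (l * k - (n + 1 / 2) * k) ^ m • c m) n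
      - evenCorr k j
        (fun l : ℤ => ∑ m ∈ range (2 * j + 2), (l * k - (n + 1 / 2) * k) ^ m • c m) n = c 0 := by
  rw [evenCorr_sum hk, avgMid, ← Finset.sum_add_distrib, Finset.smul_sum,
    ← Finset.sum_sub_distrib, Finset.sum_eq_single 0]
  · have := avgMid_sub_evenCorr_monomial hk j 0 n (c 0)
    rw [evenMoment_eq_ite j (by omega), if_pos rfl, pow_zero, one_mul, one_smul] at this
    exact this
  · intro m hm hm1
    have := avgMid_sub_evenCorr_monomial hk j m n (c m)
    rw [evenMoment_eq_ite j (by have := Finset.mem_range.1 hm; omega), if_neg hm1, mul_zero,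
      zero_smul] at this
    exact this
  · intro h; exact absurd (Finset.mem_range.2 (by omega)) h

/-! ### Bounds for the difference formulas -/

lemma norm_dMid_sub_oddCorr_le {k : ℝ} (hk : 0 < k) (j : ℕ) (v : ℤ → X) (n : ℤ) {B : ℝ}
    (h : ∀ s : ℤ, n - j ≤ s → s ≤ n + 1 + j → ‖v s‖ ≤ B) :
    ‖dMid k v n - oddCorr k j v n‖ ≤
      k⁻¹ * ((2 + ∑ i ∈ Finset.Icc 1 j, |cOdd i| * 2 ^ (2 * i + 1)) * B) := by
  have h0 : ‖dMid k v n‖ ≤ k⁻¹ * (2 * B) := by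
    rw [dMid, norm_smul, norm_inv, Real.norm_of_nonneg hk.le]
    have h1 := h (n + 1) (by omega) (by omega)
    have h2 := h n (by omega) (by omega)
    gcongr
    linarith [norm_sub_le (v (n + 1)) (v n)]
  have h1 : ‖oddCorr k j v n‖ ≤ ∑ i ∈ Finset.Icc 1 j, k⁻¹ * (|cOdd i| * 2 ^ (2 * i + 1) * B) := by
    rw [oddCorr_eq hk.ne']
    refine norm_sum_le_of_le _ fun i hi => ?_
    have hi' := Finset.mem_Icc.1 hi
    rw [norm_smul, norm_mul, norm_inv, Real.norm_of_nonneg hk.le, Real.norm_eq_abs]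
    calc |cOdd i| * k⁻¹ * _ ≤ |cOdd i| * k⁻¹ * (2 ^ (2 * i + 1) * B) := by
          gcongr
          exact norm_fwdDiff_iter_le _ _ _ fun s hs hs' => h s (by omega) (by push_cast at hs'; omega)
      _ = _ := by ring
  calc _ ≤ _ := norm_sub_le _ _
    _ ≤ _ := add_le_add h0 h1
    _ = _ := by rw [← Finset.mul_sum, ← Finset.sum_mul]; ring

lemma norm_avgMid_sub_evenCorr_le {k : ℝ} (hk : 0 < k) (j : ℕ) (v : ℤ → X) (n : ℤ) {B : ℝ}
    (h : ∀ s : ℤ, n - j ≤ s → s ≤ n + 1 + j → ‖v s‖ ≤ B) :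
    ‖avgMid v n - evenCorr k j v n‖ ≤
      (1 + ∑ i ∈ Finset.Icc 1 j, |cEven i| * 2 ^ (2 * i)) * B := by
  have h0 : ‖avgMid v n‖ ≤ B := by
    rw [avgMid, norm_smul, norm_inv, Real.norm_of_nonneg zero_le_two]
    have h1 := h (n + 1) (by omega) (by omega)
    have h2 := h n (by omega) (by omega)
    linarith [norm_add_le (v (n + 1)) (v n)]
  have h1 : ‖evenCorr k j v n‖ ≤ ∑ i ∈ Finset.Icc 1 j, |cEven i| * 2 ^ (2 * i) * B := by
    rw [evenCorr_eq hk.ne']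
    refine norm_sum_le_of_le _ fun i hi => ?_
    have hi' := Finset.mem_Icc.1 hi
    rw [norm_smul, norm_mul, norm_inv, Real.norm_of_nonneg zero_le_two, Real.norm_eq_abs]
    have h1 : ‖(fwdDiff (1 : ℤ))^[2 * i] v (n - i + 1)‖ ≤ 2 ^ (2 * i) * B :=
      norm_fwdDiff_iter_le _ _ _ fun s hs hs' => h s (by omega) (by push_cast at hs'; omega)
    have h2 : ‖(fwdDiff (1 : ℤ))^[2 * i] v (n - i)‖ ≤ 2 ^ (2 * i) * B :=
      norm_fwdDiff_iter_le _ _ _ fun s hs hs' => h s (by omega) (by push_cast at hs'; omega)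
    calc |cEven i| * 2⁻¹ * _ ≤ |cEven i| * 2⁻¹ * (2 ^ (2 * i) * B + 2 ^ (2 * i) * B) := by
          gcongr
          exact (norm_add_le _ _).trans (add_le_add h1 h2)
      _ = _ := by ring
  calc _ ≤ _ := norm_sub_le _ _
    _ ≤ _ := add_le_add h0 h1
    _ = _ := by rw [← Finset.sum_mul]; ring

lemma fwdDiff_iter_two_eq {k : ℝ} (hk : k ≠ 0) (v : ℤ → X) (m : ℤ) :
    (fwdDiff (1 : ℤ))^[2] v m = k ^ 2 • dPM k 1 v (m + 1) := by
  rw [dPM_eq_fwdDiff, smul_smul, inv_pow, mul_one, mul_inv_cancel₀ (pow_ne_zero 2 hk), one_smul]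
  simp

lemma fwdDiff_iter_three_eq {k : ℝ} (hk : k ≠ 0) (v : ℤ → X) (m : ℤ) :
    (fwdDiff (1 : ℤ))^[3] v m = k ^ 3 • dMid k (dPM k 1 v) (m + 1) := by
  rw [Function.iterate_succ_apply', fwdDiff, fwdDiff_iter_two_eq hk, fwdDiff_iter_two_eq hk,
    ← smul_sub, dMid, smul_smul]
  congr 1
  field_simp

/-- Each difference of order `2i+1` is split into a third one, equal to `k^3` times the quantity
bounded by `B`, and `2(i-1)` undivided ones costing a factor 2 each. With the prefactor `k⁻¹` this
leaves `k^2`, so no bound on higher divided differences is needed. -/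
lemma norm_oddCorr_le {k : ℝ} (hk : 0 < k) (j : ℕ) (v : ℤ → X) (n : ℤ) {B : ℝ}
    (h : ∀ s : ℤ, n - j + 1 ≤ s → s ≤ n + j - 1 → ‖dMid k (dPM k 1 v) s‖ ≤ B) :
    ‖oddCorr k j v n‖ ≤ (∑ i ∈ Finset.Icc 1 j, |cOdd i| * 2 ^ (2 * (i - 1))) * (k ^ 2 * B) := by
  rw [oddCorr_eq hk.ne', Finset.sum_mul]
  refine norm_sum_le_of_le _ fun i hi => ?_
  obtain ⟨hi1, hi2⟩ := Finset.mem_Icc.1 hi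
  obtain ⟨s, rfl⟩ := Nat.exists_eq_add_of_le' hi1
  have e : 2 * (s + 1) + 1 = 2 * s + 3 := by ring
  have h3 : (fwdDiff (1 : ℤ))^[3] v = k ^ 3 • fun m => dMid k (dPM k 1 v) (m + 1) :=
    funext fun m => fwdDiff_iter_three_eq hk.ne' v m
  rw [e, Function.iterate_add_apply, h3, fwdDiff_iter_const_smul, Pi.smul_apply, smul_smul,
    norm_smul, norm_mul, norm_mul, norm_pow, norm_inv, Real.norm_of_nonneg hk.le,
    Real.norm_eq_abs, Nat.add_sub_cancel]
  have hb := norm_fwdDiff_iter_le (2 * s) (fun m => dMid k (dPM k 1 v) (m + 1))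
    (n - (s + 1 : ℕ)) (B := B)
    fun r hr hr' => h _ (by push_cast at hr; omega) (by push_cast at hr'; omega)
  calc _ ≤ |cOdd (s + 1)| * k⁻¹ * k ^ 3 * (2 ^ (2 * s) * B) := by gcongr
    _ = _ := by field_simp

lemma norm_evenCorr_le {k : ℝ} (hk : 0 < k) (j : ℕ) (v : ℤ → X) (n : ℤ) {B : ℝ}
    (h : ∀ s : ℤ, n - j + 1 ≤ s → s ≤ n + j → ‖dPM k 1 v s‖ ≤ B) :
    ‖evenCorr k j v n‖ ≤ (∑ i ∈ Finset.Icc 1 j, |cEven i| * 2 ^ (2 * (i - 1))) * (k ^ 2 * B) := by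
  rw [evenCorr_eq hk.ne', Finset.sum_mul]
  refine norm_sum_le_of_le _ fun i hi => ?_
  obtain ⟨hi1, hi2⟩ := Finset.mem_Icc.1 hi
  obtain ⟨s, rfl⟩ := Nat.exists_eq_add_of_le' hi1
  have e : 2 * (s + 1) = 2 * s + 2 := by ring
  have h3 : (fwdDiff (1 : ℤ))^[2] v = k ^ 2 • fun m => dPM k 1 v (m + 1) :=
    funext fun m => fwdDiff_iter_two_eq hk.ne' v m
  rw [e, Function.iterate_add_apply, h3, fwdDiff_iter_const_smul,
    Pi.smul_apply, Pi.smul_apply, ← smul_add, smul_smul, norm_smul, norm_mul, norm_mul, norm_pow,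
    norm_inv, Real.norm_of_nonneg hk.le, Real.norm_of_nonneg zero_le_two, Real.norm_eq_abs,
    Nat.add_sub_cancel]
  have hb := norm_fwdDiff_iter_le (2 * s) (fun m => dPM k 1 v (m + 1))
    (n - (s + 1 : ℕ)) (B := B)
    fun r hr hr' => h _ (by push_cast at hr; omega) (by push_cast at hr'; omega)
  have hb' := norm_fwdDiff_iter_le (2 * s) (fun m => dPM k 1 v (m + 1))
    (n - (s + 1 : ℕ) + 1) (B := B)
    fun r hr hr' => h _ (by push_cast at hr; omega) (by push_cast at hr'; omega)
  calc _ ≤ |cEven (s + 1)| * 2⁻¹ * k ^ 2 * (2 ^ (2 * s) * B + 2 ^ (2 * s) * B) := by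
        gcongr
        exact (norm_add_le _ _).trans (add_le_add hb' hb)
    _ = _ := by ring

/-! ### Taylor expansion about an arbitrary point of an interval -/

/-- Induction through the derivative: integrate its expansion termwise and bound the remainder by
the mean value inequality on the segment from `a` to `x`, where `|y - a| ≤ |x - a|`. The constant is
unchanged at each step, hence uniform in the base point; `x` may lie on either side of `a`. -/
lemma exists_taylor_bound {T : ℝ} (hT : 0 < T) (n : ℕ) (f : ℝ → X)
    (hf : ContDiffOn ℝ (n : WithTop ℕ∞) f (Set.Icc 0 T)) :
    ∃ C : ℝ, 0 ≤ C ∧ ∀ a ∈ Set.Icc 0 T, ∃ c : ℕ → X, (1 ≤ n → c 0 = f a) ∧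
      (2 ≤ n → c 1 = derivWithin f (Set.Icc 0 T) a) ∧
      ∀ x ∈ Set.Icc 0 T, ‖f x - ∑ i ∈ range n, (x - a) ^ i • c i‖ ≤ C * |x - a| ^ n := by
  induction n generalizing f with
  | zero =>
    obtain ⟨C, hC⟩ := isCompact_Icc.exists_bound_of_continuousOn hf.continuousOn
    refine ⟨C, (norm_nonneg _).trans (hC 0 ⟨le_rfl, hT.le⟩), fun a _ => ⟨fun _ => 0, ?_, ?_, ?_⟩⟩
    · omega
    · omega
    · simpa using hC
  | succ n ih =>
    have hu := uniqueDiffOn_Icc hT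
    rw [Nat.cast_succ, contDiffOn_succ_iff_derivWithin hu] at hf
    obtain ⟨hd, -, hf'⟩ := hf
    obtain ⟨C, hC0, hC⟩ := ih _ hf'
    refine ⟨C, hC0, fun a ha => ?_⟩
    obtain ⟨c, hc0, -, hc⟩ := hC a ha
    refine ⟨fun i => Nat.casesOn i (f a) fun i => ((i : ℝ) + 1)⁻¹ • c i, fun _ => rfl, fun hn => ?_,
      fun x hx => ?_⟩
    · simpa using hc0 (by omega)
    · set g : ℝ → X := fun y => f y - (f a +
        ∑ i ∈ range n, (y - a) ^ (i + 1) • (((i : ℝ) + 1)⁻¹ • c i)) with hg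
      have hg' : ∀ y ∈ Set.Icc 0 T, HasDerivWithinAt g
          (derivWithin f (Set.Icc 0 T) y - ∑ i ∈ range n, (y - a) ^ i • c i) (Set.Icc 0 T) y := by
        intro y hy
        refine (hd y hy).hasDerivWithinAt.sub (HasDerivWithinAt.const_add _ ?_)
        refine HasDerivWithinAt.fun_sum fun i _ => ?_
        have h1 : HasDerivAt (fun y : ℝ => (y - a) ^ (i + 1)) (((i : ℝ) + 1) * (y - a) ^ i) y := by
          simpa using ((hasDerivAt_id y).sub_const a).fun_pow (i + 1)
        have h2 := (h1.smul_const (((i : ℝ) + 1)⁻¹ • c i)).hasDerivWithinAt (s := Set.Icc 0 T)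
        convert h2 using 1
        rw [smul_smul]
        congr 1
        have : (i : ℝ) + 1 ≠ 0 := by positivity
        field_simp
      have hsub : Set.uIcc a x ⊆ Set.Icc 0 T := Set.uIcc_subset_Icc ha hx
      have key := (convex_uIcc a x).norm_image_sub_le_of_norm_hasDerivWithin_le
        (f := g) (C := C * |x - a| ^ n) (fun y hy => (hg' y (hsub hy)).mono hsub)
        (fun y hy => (hc y (hsub hy)).trans (by
          gcongr 1
          exact pow_le_pow_left₀ (abs_nonneg _) (Set.abs_sub_left_of_mem_uIcc hy) n))
        Set.left_mem_uIcc Set.right_mem_uIcc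
      have hga : g a = 0 := by simp [hg]
      rw [hga, sub_zero, Real.norm_eq_abs] at key
      rw [Finset.sum_range_succ', pow_succ, ← mul_assoc, pow_zero, one_smul, add_comm]
      exact key

/-! ### Consistency of the difference formulas -/

lemma abs_sub_mid_le {k : ℝ} (hk : 0 < k) (j : ℕ) (n s : ℤ) (hs : n - j ≤ s)
    (hs' : s ≤ n + 1 + j) : |(s : ℝ) * k - (n + 1 / 2) * k| ≤ (j + 1) * k := by
  have h1 : ((n - j : ℤ) : ℝ) ≤ s := Int.cast_le.2 hs
  have h2 : (s : ℝ) ≤ ((n + 1 + j : ℤ) : ℝ) := Int.cast_le.2 hs'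
  push_cast at h1 h2
  rw [← sub_mul, abs_mul, abs_of_pos hk]
  gcongr
  rw [abs_le]
  constructor <;> linarith

lemma mul_mem_Icc_of_stencil {T k : ℝ} (hk : 0 < k) {j : ℕ} {n s : ℤ} (hn : (j : ℤ) ≤ n)
    (hT : ((n : ℝ) + 1 + j) * k ≤ T) (hs : n - j ≤ s) (hs' : s ≤ n + 1 + j) :
    (s : ℝ) * k ∈ Set.Icc 0 T := by
  have h1 : (0 : ℝ) ≤ s := Int.cast_nonneg (by omega)
  have h2 : (s : ℝ) ≤ ((n + 1 + j : ℤ) : ℝ) := Int.cast_le.2 hs'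
  push_cast at h2
  exact ⟨by positivity, le_trans (by gcongr) hT⟩

lemma mid_mem_Icc {T k : ℝ} (hk : 0 < k) {j : ℕ} {n : ℤ} (hn : (j : ℤ) ≤ n)
    (hT : ((n : ℝ) + 1 + j) * k ≤ T) : ((n : ℝ) + 1 / 2) * k ∈ Set.Icc 0 T := by
  have h1 : (0 : ℝ) ≤ n := Int.cast_nonneg (by omega)
  refine ⟨by positivity, le_trans ?_ hT⟩
  have : (0 : ℝ) ≤ j := Nat.cast_nonneg j
  gcongr ?_ * k
  linarith

lemma exists_dMid_sub_oddCorr_bound {T : ℝ} (hT : 0 < T) (j : ℕ) (u : ℝ → X)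
    (hu : ContDiffOn ℝ ((2 * j + 3 : ℕ) : WithTop ℕ∞) u (Set.Icc 0 T)) :
    ∃ C : ℝ, 0 ≤ C ∧ ∀ k : ℝ, 0 < k → ∀ n : ℤ, (j : ℤ) ≤ n → ((n : ℝ) + 1 + j) * k ≤ T →
      ‖dMid k (fun l : ℤ => u (l * k)) n - oddCorr k j (fun l : ℤ => u (l * k)) n
        - derivWithin u (Set.Icc 0 T) ((n + 1 / 2) * k)‖ ≤ C * k ^ (2 * j + 2) := by
  obtain ⟨C, hC0, hC⟩ := exists_taylor_bound hT _ u hu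
  refine ⟨(2 + ∑ i ∈ Finset.Icc 1 j, |cOdd i| * 2 ^ (2 * i + 1)) * (C * (j + 1) ^ (2 * j + 3)),
    by positivity, fun k hk n hn hnT => ?_⟩
  obtain ⟨c, -, hc1, hc⟩ := hC _ (mid_mem_Icc hk hn hnT)
  -- The formula returns exactly `c 1`, the derivative at the midpoint, on the Taylor polynomial
  -- `P`; the remainder `R` is `O(k^(2j+3))` on the stencil and loses one power of `k`.
  set P : ℤ → X := fun l : ℤ => ∑ m ∈ range (2 * j + 3), (l * k - (n + 1 / 2) * k) ^ m • c m with hP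
  set R : ℤ → X := fun l : ℤ => u (l * k) - P l with hR
  have hsum : (fun l : ℤ => u (l * k)) = P + R := by
    funext l; simp [hR]
  have hRb := norm_dMid_sub_oddCorr_le hk j R n (B := C * ((j + 1) * k) ^ (2 * j + 3))
    fun s hs hs' => (hc _ (mul_mem_Icc_of_stencil hk hn hnT hs hs')).trans (by
      gcongr
      exact abs_sub_mid_le hk j n s hs hs')
  have hPe := dMid_sub_oddCorr_polynomial hk.ne' j n c
  rw [← hP] at hPe
  rw [hsum, dMid_add, oddCorr_add hk.ne', ← hc1 (by omega), ← hPe]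
  have e : dMid k P n + dMid k R n - (oddCorr k j P n + oddCorr k j R n)
      - (dMid k P n - oddCorr k j P n) = dMid k R n - oddCorr k j R n := by abel
  rw [e]
  refine hRb.trans (le_of_eq ?_)
  rw [mul_pow, pow_succ k (2 * j + 2)]
  field_simp

lemma exists_avgMid_sub_evenCorr_bound {T : ℝ} (hT : 0 < T) (j : ℕ) (u : ℝ → X)
    (hu : ContDiffOn ℝ ((2 * j + 2 : ℕ) : WithTop ℕ∞) u (Set.Icc 0 T)) :
    ∃ C : ℝ, 0 ≤ C ∧ ∀ k : ℝ, 0 < k → ∀ n : ℤ, (j : ℤ) ≤ n → ((n : ℝ) + 1 + j) * k ≤ T →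
      ‖avgMid (fun l : ℤ => u (l * k)) n - evenCorr k j (fun l : ℤ => u (l * k)) n
        - u ((n + 1 / 2) * k)‖ ≤ C * k ^ (2 * j + 2) := by
  obtain ⟨C, hC0, hC⟩ := exists_taylor_bound hT _ u hu
  refine ⟨(1 + ∑ i ∈ Finset.Icc 1 j, |cEven i| * 2 ^ (2 * i)) * (C * (j + 1) ^ (2 * j + 2)),
    by positivity, fun k hk n hn hnT => ?_⟩
  obtain ⟨c, hc0, -, hc⟩ := hC _ (mid_mem_Icc hk hn hnT)
  set P : ℤ → X := fun l : ℤ => ∑ m ∈ range (2 * j + 2), (l * k - (n + 1 / 2) * k) ^ m • c m with hP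
  set R : ℤ → X := fun l : ℤ => u (l * k) - P l with hR
  have hsum : (fun l : ℤ => u (l * k)) = P + R := by
    funext l; simp [hR]
  have hRb := norm_avgMid_sub_evenCorr_le hk j R n (B := C * ((j + 1) * k) ^ (2 * j + 2))
    fun s hs hs' => (hc _ (mul_mem_Icc_of_stencil hk hn hnT hs hs')).trans (by
      gcongr
      exact abs_sub_mid_le hk j n s hs hs')
  have hPe := avgMid_sub_evenCorr_polynomial hk.ne' j n c
  rw [← hP] at hPe
  rw [hsum, avgMid_add, evenCorr_add hk.ne', ← hc0 (by omega), ← hPe]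
  have e : avgMid P n + avgMid R n - (evenCorr k j P n + evenCorr k j R n)
      - (avgMid P n - evenCorr k j P n) = avgMid R n - evenCorr k j R n := by abel
  rw [e]
  refine hRb.trans (le_of_eq ?_)
  rw [mul_pow]
  ring

/-! ### Lipschitz bounds near the exact solution -/

/-- In infinite dimension a tube around the trajectory is not compact, so the local Lipschitz
neighbourhoods are patched together by compactness of `[0, T]` only. -/
lemma exists_lipschitz_near {T : ℝ} {F : ℝ → X → X} {u : ℝ → X}
    (hF : ContDiffOn ℝ 1 (Function.uncurry F) (Set.Icc 0 T ×ˢ univ))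
    (hu : ContinuousOn u (Set.Icc 0 T)) :
    ∃ K δ : ℝ, 0 ≤ K ∧ 0 < δ ∧ ∀ t ∈ Set.Icc 0 T, ∀ x y : X, ‖x - u t‖ ≤ δ → ‖y - u t‖ ≤ δ →
      ‖F t x - F t y‖ ≤ K * ‖x - y‖ := by
  -- The membership in `Icc 0 T` is repeated because compactness induction runs over arbitrary sets
  -- of times in place of the first one.
  have main : ∃ K δ : ℝ, 0 ≤ K ∧ 0 < δ ∧ ∀ t ∈ Set.Icc 0 T, t ∈ Set.Icc 0 T → ∀ x y : X,
      ‖x - u t‖ ≤ δ → ‖y - u t‖ ≤ δ → ‖F t x - F t y‖ ≤ K * ‖x - y‖ := by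
    refine isCompact_Icc.induction_on
      (p := fun S : Set ℝ => ∃ K δ : ℝ, 0 ≤ K ∧ 0 < δ ∧ ∀ t ∈ S, t ∈ Set.Icc 0 T → ∀ x y : X,
        ‖x - u t‖ ≤ δ → ‖y - u t‖ ≤ δ → ‖F t x - F t y‖ ≤ K * ‖x - y‖) ?_ ?_ ?_ ?_
    · exact ⟨0, 1, le_rfl, one_pos, fun t ht => absurd ht (Set.notMem_empty t)⟩
    · rintro s t hst ⟨K, δ, hK, hδ, h⟩
      exact ⟨K, δ, hK, hδ, fun r hr => h r (hst hr)⟩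
    · rintro s t ⟨K, δ, hK, hδ, h⟩ ⟨K', δ', hK', hδ', h'⟩
      refine ⟨max K K', min δ δ', le_max_of_le_left hK, lt_min hδ hδ', ?_⟩
      rintro r (hr | hr) hrT x y hx hy
      · refine (h r hr hrT x y (hx.trans (min_le_left _ _)) (hy.trans (min_le_left _ _))).trans ?_
        gcongr; exact le_max_left _ _
      · refine (h' r hr hrT x y (hx.trans (min_le_right _ _))
          (hy.trans (min_le_right _ _))).trans ?_
        gcongr; exact le_max_right _ _
    · intro t₀ ht₀
      obtain ⟨K, S, hS, hK⟩ := (hF (t₀, u t₀) ⟨ht₀, mem_univ _⟩).exists_lipschitzOnWith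
        ((convex_Icc 0 T).prod convex_univ)
      obtain ⟨r, hr, hrS⟩ := Metric.mem_nhdsWithin_iff.1 hS
      have hc := (Metric.continuousWithinAt_iff.1 (hu t₀ ht₀)) (r / 2) (half_pos hr)
      obtain ⟨η, hη, hη'⟩ := hc
      -- Since `r/3 + r/2 < r`, points within `r/3` of `u t` stay within `r` of `u t₀`.
      refine ⟨Metric.ball t₀ (min η r), mem_nhdsWithin_of_mem_nhds ?_, K, r / 3,
        K.2, by positivity, ?_⟩
      · exact Metric.ball_mem_nhds _ (lt_min hη hr)
      intro t ht htT x y hx hy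
      have ht1 : dist t t₀ < η := ht.trans_le (min_le_left _ _)
      have ht2 : dist t t₀ < r := ht.trans_le (min_le_right _ _)
      have hu' := hη' htT ht1
      have hmem : ∀ z : X, ‖z - u t‖ ≤ r / 3 → (t, z) ∈ S := by
        intro z hz
        refine hrS ⟨?_, htT, mem_univ _⟩
        rw [Metric.mem_ball, Prod.dist_eq]
        refine max_lt ht2 ?_
        have := dist_triangle z (u t) (u t₀)
        rw [dist_eq_norm z (u t)] at this
        simp only
        linarith
      have := hK.dist_le_mul _ (hmem x hx) _ (hmem y hy)
      rw [Prod.dist_eq, dist_self, max_eq_right dist_nonneg, dist_eq_norm, dist_eq_norm] at this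
      exact this
  obtain ⟨K, δ, hK, hδ, h⟩ := main
  exact ⟨K, δ, hK, hδ, fun t ht => h t ht ht⟩

lemma exists_lipschitz_of_finiteDimensional [FiniteDimensional ℝ X] {T : ℝ} (hT : 0 < T)
    {F : ℝ → X → X} {u : ℝ → X}
    (hF : ContDiffOn ℝ 1 (Function.uncurry F) (Set.Icc 0 T ×ˢ univ))
    (hu : ContinuousOn u (Set.Icc 0 T)) (R : ℝ) :
    ∃ K : ℝ, 0 ≤ K ∧ ∀ t ∈ Set.Icc 0 T, ∀ x y : X, ‖x - u t‖ ≤ R → ‖y - u t‖ ≤ R →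
      ‖F t x - F t y‖ ≤ K * ‖x - y‖ := by
  have := FiniteDimensional.proper ℝ X
  obtain ⟨B, hB⟩ := isCompact_Icc.exists_bound_of_continuousOn hu
  have hS : UniqueDiffOn ℝ (Set.Icc 0 T ×ˢ (univ : Set X)) :=
    (uniqueDiffOn_Icc hT).prod uniqueDiffOn_univ
  -- The tube is enlarged to a product with a ball: this set is compact, so the derivative is
  -- bounded, and convex, so the mean value inequality applies.
  have hQ : IsCompact (Set.Icc 0 T ×ˢ Metric.closedBall (0 : X) (B + R)) :=
    isCompact_Icc.prod (isCompact_closedBall _ _)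
  have hsub : Set.Icc 0 T ×ˢ Metric.closedBall (0 : X) (B + R) ⊆ Set.Icc 0 T ×ˢ univ :=
    Set.prod_mono le_rfl (subset_univ _)
  obtain ⟨K, hK⟩ := hQ.exists_bound_of_continuousOn
    ((hF.continuousOn_fderivWithin hS le_rfl).mono hsub)
  have hlip := fun z hz z' hz' =>
    ((convex_Icc 0 T).prod
      (convex_closedBall (0 : X) (B + R))).norm_image_sub_le_of_norm_hasFDerivWithin_le
      (f := Function.uncurry F) (x := z) (y := z')
      (fun z hz => (hF.differentiableOn one_ne_zero z (hsub hz)).hasFDerivWithinAt.mono hsub)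
      hK hz hz'
  refine ⟨max K 0, le_max_right _ _, fun t ht x y hx hy => ?_⟩
  have hmem : ∀ z : X, ‖z - u t‖ ≤ R →
      (t, z) ∈ Set.Icc 0 T ×ˢ Metric.closedBall (0 : X) (B + R) := by
    intro z hz
    refine ⟨ht, ?_⟩
    rw [mem_closedBall_zero_iff]
    have := norm_add_le (u t) (z - u t)
    rw [add_sub_cancel] at this
    exact this.trans (add_le_add (hB t ht) hz)
  have h := hlip _ (hmem y hy) _ (hmem x hx)
  have e : ‖((t, x) : ℝ × X) - (t, y)‖ = ‖x - y‖ := by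
    rw [Prod.mk_sub_mk, sub_self, Prod.norm_mk, norm_zero, max_eq_right (norm_nonneg _)]
  rw [e] at h
  exact h.trans (by gcongr; exact le_max_left _ _)

/-! ### A discrete Gronwall inequality -/

lemma le_exp_mul_of_succ_sub_le {a : ℕ → ℝ} (ha : ∀ n, 0 ≤ a n) {h K D A : ℝ} (hh : 0 ≤ h)
    (hK : 0 ≤ K) (hD : 0 ≤ D) (hA : 0 ≤ A) (hhK : h * K ≤ 1 / 2) {j N : ℕ}
    (hstart : ∀ n ≤ j, n ≤ N → a n ≤ A)
    (hstep : ∀ n, j ≤ n → n + 1 ≤ N → a (n + 1) - a n ≤ h * K * (a (n + 1) + a n) + h * D) :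
    ∀ n ≤ N, a n ≤ Real.exp (4 * K * (n * h)) * (A + 2 * D * (n * h)) := by
  have hge : ∀ n : ℕ, 1 ≤ Real.exp (4 * K * (n * h)) := fun n =>
    Real.one_le_exp (by positivity)
  intro n
  induction n with
  | zero => intro hn; simpa using hstart 0 (Nat.zero_le _) hn
  | succ n ih =>
    intro hn
    rcases le_or_gt (n + 1) j with hj | hj
    · have h1 : A ≤ A + 2 * D * ((n + 1 : ℕ) * h) := le_add_of_nonneg_right (by positivity)
      exact ((hstart _ hj hn).trans h1).trans
        (le_mul_of_one_le_left (by positivity) (hge _))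
    · have hs := hstep n (by omega) hn
      have hi := ih (by omega)
      set x := h * K with hx
      have hx0 : 0 ≤ x := by positivity
      have hu0 := ha (n + 1)
      -- The step is implicit: solving for `a (n + 1)` uses `(1 + x)/(1 - x) ≤ 1 + 4x` and `1/(1 -
      -- x) ≤ 2`, both valid for `0 ≤ x ≤ 1/2`.
      have h1 : a (n + 1) ≤ (1 + 4 * x) * a n + 2 * (h * D) := by
        have e1 : (1 - x) * a (n + 1) ≤ (1 - x) * ((1 + 4 * x) * a n + 2 * (h * D)) := by
          have e2 : 0 ≤ x * (1 - 2 * x) * a n := by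
            have := ha n
            have : 0 ≤ 1 - 2 * x := by linarith
            positivity
          have e3 : 0 ≤ (1 - 2 * x) * (h * D) := by
            have : 0 ≤ 1 - 2 * x := by linarith
            positivity
          nlinarith
        exact le_of_mul_le_mul_left e1 (by linarith)
      have h2 : Real.exp (4 * K * ((n + 1 : ℕ) * h)) =
          Real.exp (4 * x) * Real.exp (4 * K * (n * h)) := by
        rw [← Real.exp_add]; congr 1; push_cast; ring
      have h3 : 1 + 4 * x ≤ Real.exp (4 * x) := by linarith [Real.add_one_le_exp (4 * x)]
      calc a (n + 1) ≤ (1 + 4 * x) * a n + 2 * (h * D) := h1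
        _ ≤ Real.exp (4 * x) * (Real.exp (4 * K * (n * h)) * (A + 2 * D * (n * h)))
            + Real.exp (4 * K * ((n + 1 : ℕ) * h)) * (2 * (h * D)) := by
          have := ha n
          refine add_le_add (by gcongr) (le_mul_of_one_le_left (by positivity) (hge _))
        _ = _ := by rw [h2]; push_cast; ring

/-! ### The error equation -/

lemma exists_norm_corr_le (j : ℕ) (hj : 1 ≤ j) :
    ∃ A : ℝ, 0 ≤ A ∧ ∀ k : ℝ, 0 < k → k ≤ 1 → ∀ (ε : ℤ → X) (L : ℕ) (B : ℝ),
      (∀ n : ℤ, 1 ≤ n → n + 2 ≤ L → ‖dMid k (dPM k 1 ε) n‖ + ‖dPM k 1 ε (n + 1)‖ ≤ B) →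
      ∀ n : ℤ, (j : ℤ) ≤ n → n + 1 + j ≤ L →
        ‖oddCorr k j ε n‖ ≤ A * (k ^ 2 * B) ∧ ‖evenCorr k j ε n‖ ≤ A * (k ^ 2 * B) := by
  set A₁ := ∑ i ∈ Finset.Icc 1 j, |cOdd i| * 2 ^ (2 * (i - 1)) with hA₁
  set A₂ := ∑ i ∈ Finset.Icc 1 j, |cEven i| * 2 ^ (2 * (i - 1)) with hA₂
  have hA₁0 : 0 ≤ A₁ := Finset.sum_nonneg fun i _ => by positivity
  have hA₂0 : 0 ≤ A₂ := Finset.sum_nonneg fun i _ => by positivity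
  refine ⟨A₁ + 2 * A₂, by positivity, fun k hk hk1 ε L B h n hn hnL => ?_⟩
  have hz : ∀ s : ℤ, 1 ≤ s → s + 2 ≤ L → ‖dMid k (dPM k 1 ε) s‖ ≤ B := fun s hs hs' =>
    (le_add_of_nonneg_right (norm_nonneg _)).trans (h s hs hs')
  have hy : ∀ s : ℤ, 2 ≤ s → s + 1 ≤ L → ‖dPM k 1 ε s‖ ≤ B := fun s hs hs' => by
    have := (le_add_of_nonneg_left (norm_nonneg _)).trans (h (s - 1) (by omega) (by omega))
    rwa [sub_add_cancel] at this
  have hB : 0 ≤ B := (norm_nonneg _).trans (hz 1 le_rfl (by omega))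
  -- the second difference at the first interior point is controlled through the third difference
  have hy1 : ‖dPM k 1 ε 1‖ ≤ 2 * B := by
    have h1 := h 1 le_rfl (by omega)
    have e : dPM k 1 ε 1 = dPM k 1 ε (1 + 1) - k • dMid k (dPM k 1 ε) 1 := by
      rw [dMid, smul_smul, mul_inv_cancel₀ hk.ne', one_smul]; abel
    have h2 : ‖k • dMid k (dPM k 1 ε) 1‖ ≤ ‖dMid k (dPM k 1 ε) 1‖ := by
      rw [norm_smul, Real.norm_of_nonneg hk.le]
      exact mul_le_of_le_one_left (norm_nonneg _) hk1
    rw [e]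
    linarith [norm_sub_le (dPM k 1 ε (1 + 1)) (k • dMid k (dPM k 1 ε) 1)]
  have h1 := norm_oddCorr_le hk j ε n (B := B) fun s hs hs' => hz s (by omega) (by omega)
  have h2 := norm_evenCorr_le hk j ε n (B := 2 * B) fun s hs hs' => by
    rcases eq_or_lt_of_le (show 1 ≤ s by omega) with rfl | h1s
    · exact hy1
    · exact (hy s (by omega) (by omega)).trans (by linarith)
  rw [← hA₁] at h1
  rw [← hA₂] at h2
  have hkB : 0 ≤ k ^ 2 * B := by positivity
  constructor
  · refine h1.trans (mul_le_mul_of_nonneg_right (by linarith) hkB)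
  · refine h2.trans (le_trans (le_of_eq ?_)
      (mul_le_mul_of_nonneg_right (show 2 * A₂ ≤ A₁ + 2 * A₂ by linarith) hkB))
    ring

lemma exists_error_equation {T : ℝ} (hT : 0 < T) {F : ℝ → X → X} {u₀ : X} {u : ℝ → X} {j : ℕ}
    (hj : 1 ≤ j) (hu : ContDiffOn ℝ ((2 * j + 3 : ℕ) : WithTop ℕ∞) u (Set.Icc 0 T))
    (hsol : IsSolution F T u₀ u) {ι : Type*} {k : ι → ℝ} {L N : ι → ℕ} (hk : ∀ g, 0 < k g)
    (hL : ∀ g, (L g : ℝ) * k g ≤ T) (hN : ∀ g, N g + j ≤ L g) {v w : ι → ℤ → X}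
    (hv : DCC u k L v j)
    (hw : ∀ g, ∀ n : ℤ, (j : ℤ) ≤ n → n + 1 ≤ N g → DCStep F j (k g) (v g) (w g) n) :
    ∃ C k₀ : ℝ, 0 ≤ C ∧ 0 < k₀ ∧ k₀ ≤ 1 ∧ ∀ g, k g ≤ k₀ → ∀ n : ℤ, (j : ℤ) ≤ n → n + 1 ≤ N g →
      ((n : ℝ) + 1 / 2) * k g ∈ Set.Icc 0 T ∧ ∃ σ τ : X,
        ‖σ‖ ≤ C * k g ^ (2 * j + 2) ∧ ‖τ‖ ≤ C * k g ^ (2 * j + 2) ∧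
        dMid (k g) (gridError u (k g) (w g)) n =
          F ((n + 1 / 2) * k g)
            (u ((n + 1 / 2) * k g) + τ + avgMid (gridError u (k g) (w g)) n)
          - F ((n + 1 / 2) * k g) (u ((n + 1 / 2) * k g)) + σ := by
  obtain ⟨C₁, hC₁, h₁⟩ := exists_dMid_sub_oddCorr_bound hT j u hu
  obtain ⟨C₂, hC₂, h₂⟩ := exists_avgMid_sub_evenCorr_bound hT j u
    (hu.of_le (by exact_mod_cast Nat.le_succ _))
  obtain ⟨-, C, k₀, hk₀, hC⟩ := hv
  obtain ⟨A, hA, hA'⟩ := exists_norm_corr_le (X := X) j hj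
  refine ⟨C₁ + C₂ + A * |C|, min k₀ 1, by positivity, lt_min hk₀ one_pos, min_le_right _ _,
    fun g hg n hn hnN => ?_⟩
  have hkg := hk g
  have hnL : n + 1 + j ≤ (L g : ℤ) := by have := hN g; omega
  have hnT : ((n : ℝ) + 1 + j) * k g ≤ T := by
    refine le_trans ?_ (hL g)
    gcongr
    have : ((n + 1 + j : ℤ) : ℝ) ≤ ((L g : ℤ) : ℝ) := Int.cast_le.2 hnL
    push_cast at this
    exact this
  have hmid := mid_mem_Icc hkg hn hnT
  refine ⟨hmid, ?_⟩
  set U : ℤ → X := fun l : ℤ => u (l * k g) with hU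
  set e := gridError u (k g) (w g) with he
  set ε := gridError u (k g) (v g) with hε
  set t := ((n : ℝ) + 1 / 2) * k g with ht
  have hwU : w g = U + e := by funext l; simp [hU, he, gridError]
  have hvU : v g = U + ε := by funext l; simp [hU, hε, gridError]
  obtain ⟨ho, hev⟩ := hA' (k g) hkg (hg.trans (min_le_right _ _)) ε (L g) _
    (hC g (hg.trans (min_le_left _ _))) n hn hnL
  have hc₁ := h₁ (k g) hkg n hn hnT
  have hc₂ := h₂ (k g) hkg n hn hnT
  rw [← hU, ← ht] at hc₁ hc₂
  rw [(hsol.1 t hmid).derivWithin (uniqueDiffOn_Icc hT t hmid)] at hc₁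
  have hAC : A * (k g ^ 2 * (C * k g ^ (2 * j))) ≤ A * |C| * k g ^ (2 * j + 2) := by
    have : A * (k g ^ 2 * (C * k g ^ (2 * j))) = A * C * k g ^ (2 * j + 2) := by ring
    rw [this]
    gcongr
    exact le_abs_self C
  have hp : 0 ≤ k g ^ (2 * j + 2) := by positivity
  -- Each perturbation combines the truncation error of a formula on `u` with the correction
  -- operator acting on `ε`; `σ` collects those of the derivative, `τ` those of the argument of `F`.
  refine ⟨oddCorr (k g) j ε n - (dMid (k g) U n - oddCorr (k g) j U n - F t (u t)),
    (avgMid U n - evenCorr (k g) j U n - u t) - evenCorr (k g) j ε n, ?_, ?_, ?_⟩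
  · refine (norm_sub_le _ _).trans ?_
    have : 0 ≤ C₂ * k g ^ (2 * j + 2) := by positivity
    linarith
  · refine (norm_sub_le _ _).trans ?_
    have : 0 ≤ C₁ * k g ^ (2 * j + 2) := by positivity
    linarith
  · have hs : dMid (k g) (w g) n - oddCorr (k g) j (v g) n =
        F t (avgMid (w g) n - evenCorr (k g) j (v g) n) := hw g n hn hnN
    rw [hwU, hvU, dMid_add, avgMid_add, oddCorr_add hkg.ne', evenCorr_add hkg.ne'] at hs
    have e1 : u t + (avgMid U n - evenCorr (k g) j U n - u t - evenCorr (k g) j ε n)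
        + avgMid e n = avgMid U n + avgMid e n
          - (evenCorr (k g) j U n + evenCorr (k g) j ε n) := by abel
    rw [e1, ← hs]
    abel

/-! ### Stability -/

omit [NormedSpace ℝ X] in
lemma hasOrder_of_step {T : ℝ} {u₀ : X} {u : ℝ → X} {j q : ℕ} (hu0 : u 0 = u₀) {ι : Type*}
    {k : ι → ℝ} {N : ι → ℕ} (hk : ∀ g, 0 < k g) (hN : ∀ g, (N g : ℝ) * k g ≤ T)
    {w : ι → ℤ → X} (hw₀ : ∀ g, w g 0 = u₀)
    (hstart : ∃ C k₀ : ℝ, 0 < k₀ ∧ ∀ g, k g ≤ k₀ → ∀ n : ℤ, 1 ≤ n → n ≤ j → n ≤ N g →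
      ‖gridError u (k g) (w g) n‖ ≤ C * k g ^ q)
    (hstep : ∃ K D k₀ : ℝ, 0 ≤ K ∧ 0 ≤ D ∧ 0 < k₀ ∧ ∀ g, k g ≤ k₀ → ∀ n : ℤ, (j : ℤ) ≤ n →
      n + 1 ≤ N g →
      ‖gridError u (k g) (w g) (n + 1)‖ - ‖gridError u (k g) (w g) n‖ ≤
        k g * K * (‖gridError u (k g) (w g) (n + 1)‖ + ‖gridError u (k g) (w g) n‖)
          + k g * (D * k g ^ q)) :
    HasOrder u k N w q := by
  obtain ⟨C, k₁, hk₁, hC⟩ := hstart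
  obtain ⟨K, D, k₂, hK, hD, hk₂, hstep⟩ := hstep
  -- The third bound on the step forces `k K ≤ 1/2` for Gronwall, with `K + 1` covering `K = 0`;
  -- `|C|` keeps the bound nonnegative at index `0`, where the error vanishes.
  refine ⟨Real.exp (4 * K * T) * (|C| + 2 * D * T), min (min k₁ k₂) (1 / (2 * (K + 1))),
    lt_min (lt_min hk₁ hk₂) (by positivity), fun g hg n hn hnN => ?_⟩
  have hkg := hk g
  have hg1 : k g ≤ k₁ := hg.trans ((min_le_left _ _).trans (min_le_left _ _))
  have hg2 : k g ≤ k₂ := hg.trans ((min_le_left _ _).trans (min_le_right _ _))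
  have hg3 : k g * K ≤ 1 / 2 := by
    have h := (le_div_iff₀ (by positivity)).1 (hg.trans (min_le_right _ _))
    nlinarith
  obtain ⟨m, rfl⟩ := Int.eq_ofNat_of_zero_le hn
  have hmN : m ≤ N g := by exact_mod_cast hnN
  have key := le_exp_mul_of_succ_sub_le (a := fun n : ℕ => ‖gridError u (k g) (w g) n‖)
    (h := k g) (K := K) (D := D * k g ^ q) (A := |C| * k g ^ q) (j := j) (N := N g)
    (fun n => norm_nonneg _) hkg.le hK (by positivity) (by positivity) hg3
    (fun n hnj hnN => by
      rcases Nat.eq_zero_or_pos n with rfl | hpos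
      · have : gridError u (k g) (w g) ((0 : ℕ) : ℤ) = 0 := by
          simp [gridError, hw₀, hu0]
        simp only [this, norm_zero]
        positivity
      · refine (hC g hg1 n (by omega) (by omega) (by omega)).trans ?_
        gcongr
        exact le_abs_self C)
    (fun n hnj hnN => by
      have := hstep g hg2 n (by omega) (by omega)
      exact_mod_cast this) m hmN
  have hmT : (m : ℝ) * k g ≤ T := le_trans (by gcongr) (hN g)
  have hT0 : 0 ≤ T := le_trans (by positivity) hmT
  refine key.trans ?_
  calc Real.exp (4 * K * (m * k g)) * (|C| * k g ^ q + 2 * (D * k g ^ q) * (m * k g))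
      ≤ Real.exp (4 * K * T) * (|C| * k g ^ q + 2 * (D * k g ^ q) * T) := by gcongr
    _ = _ := by ring

lemma sub_eq_smul_dMid {k : ℝ} (hk : k ≠ 0) (e : ℤ → X) (n : ℤ) : e (n + 1) - e n = k • dMid k e n := by
  rw [dMid, smul_smul, mul_inv_cancel₀ hk, one_smul]

lemma norm_avgMid_le (e : ℤ → X) (n : ℤ) : ‖avgMid e n‖ ≤ 2⁻¹ * (‖e (n + 1)‖ + ‖e n‖) := by
  rw [avgMid, norm_smul, norm_inv, Real.norm_of_nonneg zero_le_two]
  gcongr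
  exact norm_add_le _ _

lemma sub_le_of_lipschitz_step {k K D : ℝ} (hk : 0 < k) (hK : 0 ≤ K) {e : ℤ → X} {n : ℤ}
    {f f₀ σ τ : X} (heq : dMid k e n = f - f₀ + σ) (hf : ‖f - f₀‖ ≤ K * ‖τ + avgMid e n‖)
    (hσ : ‖σ‖ ≤ D) (hτ : ‖τ‖ ≤ D) :
    ‖e (n + 1)‖ - ‖e n‖ ≤ k * K * (‖e (n + 1)‖ + ‖e n‖) + k * ((K + 1) * D) := by
  have h1 : ‖dMid k e n‖ ≤ K * (D + 2⁻¹ * (‖e (n + 1)‖ + ‖e n‖)) + D := by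
    rw [heq]
    refine (norm_add_le _ _).trans (add_le_add (hf.trans ?_) hσ)
    gcongr
    exact (norm_add_le _ _).trans (add_le_add hτ (norm_avgMid_le e n))
  have h2 : ‖e (n + 1)‖ - ‖e n‖ ≤ k * ‖dMid k e n‖ := by
    have := norm_sub_norm_le (e (n + 1)) (e n)
    rwa [sub_eq_smul_dMid hk.ne', norm_smul, Real.norm_of_nonneg hk.le] at this
  have h3 : 0 ≤ k * K * (‖e (n + 1)‖ + ‖e n‖) := by positivity
  have h4 := mul_le_mul_of_nonneg_left h1 hk.le
  nlinarith

/-- Energy estimate: `(D e, E e)` equals `(‖e (n+1)‖² - ‖e n‖²) / (2k)`. Inserting the intermediate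
value `f₁` separates a part of nonpositive pairing with `E e` from a small one. Dividing by `‖e
(n+1)‖ + ‖e n‖` gives the bound; if that sum is zero the claim is trivial. -/
lemma sub_le_of_monotone_step {Y : Type*} [NormedAddCommGroup Y] [InnerProductSpace ℝ Y]
    {k K D : ℝ} (hk : 0 < k) {e : ℤ → Y} {n : ℤ} {f f₁ f₀ σ : Y}
    (heq : dMid k e n = f - f₀ + σ) (hmon : inner ℝ (f - f₁) (avgMid e n) ≤ 0)
    (hf : ‖f₁ - f₀‖ ≤ K * D) (hσ : ‖σ‖ ≤ D) :
    ‖e (n + 1)‖ - ‖e n‖ ≤ k * ((K + 1) * D) := by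
  have hin : inner ℝ (dMid k e n) (avgMid e n) =
      k⁻¹ * 2⁻¹ * (‖e (n + 1)‖ ^ 2 - ‖e n‖ ^ 2) := by
    rw [dMid, avgMid, real_inner_smul_left, real_inner_smul_right, inner_sub_left, inner_add_right,
      inner_add_right, real_inner_self_eq_norm_sq, real_inner_self_eq_norm_sq,
      real_inner_comm (e n) (e (n + 1))]
    ring
  have hle : inner ℝ (dMid k e n) (avgMid e n) ≤
      (K + 1) * D * (2⁻¹ * (‖e (n + 1)‖ + ‖e n‖)) := by
    have e1 : dMid k e n = (f - f₁) + (f₁ - f₀ + σ) := by rw [heq]; abel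
    rw [e1, inner_add_left]
    have h1 : ‖f₁ - f₀ + σ‖ ≤ (K + 1) * D := by
      linarith [norm_add_le (f₁ - f₀) σ]
    have h2 := (real_inner_le_norm (f₁ - f₀ + σ) (avgMid e n)).trans
      (mul_le_mul h1 (norm_avgMid_le e n) (norm_nonneg _) ((norm_nonneg _).trans h1))
    linarith
  rw [hin] at hle
  have hprod : (‖e (n + 1)‖ - ‖e n‖) * (‖e (n + 1)‖ + ‖e n‖) ≤
      k * ((K + 1) * D) * (‖e (n + 1)‖ + ‖e n‖) := by
    have := mul_le_mul_of_nonneg_left hle (by positivity : 0 ≤ 2 * k)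
    field_simp at this
    linarith
  rcases eq_or_lt_of_le (add_nonneg (norm_nonneg (e (n + 1))) (norm_nonneg (e n))) with h0 | h0
  · have h1 := norm_nonneg (e (n + 1))
    have h2 := norm_nonneg (e n)
    have h3 : 0 ≤ (K + 1) * D := by
      have := (norm_nonneg _).trans hf
      have := (norm_nonneg _).trans hσ
      linarith
    have : 0 ≤ k * ((K + 1) * D) := by positivity
    linarith
  · exact le_of_mul_le_mul_right hprod h0

end DeferredCorrection

end

/-! ### The main theorem: stability under each of the four conditions. -/

theorem theorem3 {X : Type*} [NormedAddCommGroup X] [NormedSpace ℝ X] [CompleteSpace X]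
    -- the Cauchy problem and its smooth exact solution
    (p : ℕ) (T : ℝ) (hT : 0 < T) (F : ℝ → X → X) (u₀ : X) (u : ℝ → X)
    (hF : ContDiffOn ℝ ((2 * p + 2 : ℕ) : WithTop ℕ∞) (Function.uncurry F) (Icc 0 T ×ˢ univ))
    (hu : ContDiffOn ℝ ((2 * p + 3 : ℕ) : WithTop ℕ∞) u (Icc 0 T))
    (hsol : DeferredCorrection.IsSolution F T u₀ u)
    (j : ℕ) (hj : 1 ≤ j) (hjp : j ≤ p)
    -- a family of uniform grids; on the grid `g` the sequence to be corrected lives on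
    -- `t_0, …, t_{L g}` in `[0, T]`, and the corrected sequence on `t_0, …, t_{N g}`
    {ι : Type*} (k : ι → ℝ) (L N : ι → ℕ) (hk : ∀ g, 0 < k g)
    (hL : ∀ g, (L g : ℝ) * k g ≤ T) (hN : ∀ g, N g + j ≤ L g)
    -- `v` is the sequence of order `2 j`, `w` is the corrected sequence
    (v w : ι → ℤ → X)
    (hv : DeferredCorrection.DCC u k L v j)
    (hw₀ : ∀ g, w g 0 = u₀)
    (hstart : ∃ C k₀ : ℝ, 0 < k₀ ∧ ∀ g, k g ≤ k₀ → ∀ n : ℤ, 1 ≤ n → n ≤ j → n ≤ N g →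
      ‖DeferredCorrection.gridError u (k g) (w g) n‖ ≤ C * k g ^ (2 * j + 2))
    (hw : ∀ g, ∀ n : ℤ, (j : ℤ) ≤ n → n + 1 ≤ N g →
      DeferredCorrection.DCStep F j (k g) (v g) (w g) n)
    -- one of the four conditions
    (hcond :
      (∃ μ : NNReal, ∀ t ∈ Icc 0 T, LipschitzWith μ (F t)) ∨
      DeferredCorrection.HilbertMonotone F T ∨
      (FiniteDimensional ℝ X ∧ ∃ M : ℝ, ∀ g, ∀ n : ℤ, 0 ≤ n → n ≤ N g →
        ‖DeferredCorrection.gridError u (k g) (w g) n‖ ≤ M) ∨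
      DeferredCorrection.ConvergesTo u k N w) :
    DeferredCorrection.HasOrder u k N w (2 * j + 2) := by
  open DeferredCorrection in
  have hNT : ∀ g, (N g : ℝ) * k g ≤ T := fun g => by
    refine le_trans ?_ (hL g)
    have := (hk g).le
    have h2 : N g ≤ L g := by have := hN g; omega
    gcongr
  have hF1 : ContDiffOn ℝ 1 (Function.uncurry F) (Icc 0 T ×ˢ univ) :=
    hF.of_le (by exact_mod_cast (show 1 ≤ 2 * p + 2 by omega))
  have huj : ContDiffOn ℝ ((2 * j + 3 : ℕ) : WithTop ℕ∞) u (Icc 0 T) :=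
    hu.of_le (by exact_mod_cast (show 2 * j + 3 ≤ 2 * p + 3 by omega))
  obtain ⟨C, k₀, hC, hk₀, hk₀1, herr⟩ := exists_error_equation hT hj huj hsol hk hL hN hv hw
  refine hasOrder_of_step (j := j) hsol.2 hk hNT hw₀ hstart ?_
  -- the perturbations are eventually smaller than any prescribed radius
  have hsmall : ∀ ρ : ℝ, 0 < ρ → ∀ g, k g ≤ min k₀ (ρ / (C + 1)) → k g ≤ k₀ ∧
      C * k g ^ (2 * j + 2) ≤ ρ := fun ρ hρ g hg => by
    have h1 : k g ≤ k₀ := hg.trans (min_le_left _ _)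
    refine ⟨h1, ?_⟩
    have h2 := (le_div_iff₀ (by positivity)).1 (hg.trans (min_le_right _ _))
    have h3 : k g ^ (2 * j + 2) ≤ k g :=
      pow_le_of_le_one (hk g).le (h1.trans hk₀1) (by omega)
    have h4 := mul_le_mul_of_nonneg_left h3 hC
    have := hk g
    linarith
  -- conclusion from a Lipschitz bound along the errors
  have hlip : (∃ K r ρ k₁ : ℝ, 0 ≤ K ∧ 0 < ρ ∧ 0 < k₁ ∧
      (∀ t ∈ Icc 0 T, ∀ x y : X, ‖x - u t‖ ≤ r + ρ → ‖y - u t‖ ≤ r + ρ →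
        ‖F t x - F t y‖ ≤ K * ‖x - y‖) ∧
      ∀ g, k g ≤ k₁ → ∀ n : ℤ, 0 ≤ n → n ≤ N g → ‖gridError u (k g) (w g) n‖ ≤ r) →
      ∃ K D k₀ : ℝ, 0 ≤ K ∧ 0 ≤ D ∧ 0 < k₀ ∧ ∀ g, k g ≤ k₀ → ∀ n : ℤ, (j : ℤ) ≤ n →
        n + 1 ≤ N g →
        ‖gridError u (k g) (w g) (n + 1)‖ - ‖gridError u (k g) (w g) n‖ ≤
          k g * K * (‖gridError u (k g) (w g) (n + 1)‖ + ‖gridError u (k g) (w g) n‖)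
            + k g * (D * k g ^ (2 * j + 2)) := by
    rintro ⟨K, r, ρ, k₁, hK, hρ, hk₁, hKF, hr⟩
    refine ⟨K, (K + 1) * C, min k₁ (min k₀ (ρ / (C + 1))), hK, by positivity,
      lt_min hk₁ (lt_min hk₀ (by positivity)), fun g hg n hn hnN => ?_⟩
    obtain ⟨hg0, hgρ⟩ := hsmall ρ hρ g (hg.trans (min_le_right _ _))
    obtain ⟨hmid, σ, τ, hσ, hτ, heq⟩ := herr g hg0 n hn hnN
    rw [mul_assoc (K + 1)]
    have hr1 := hr g (hg.trans (min_le_left _ _)) (n + 1) (by omega) hnN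
    have hr2 := hr g (hg.trans (min_le_left _ _)) n (by omega) (by omega)
    refine sub_le_of_lipschitz_step (hk g) hK heq ?_ hσ hτ
    have hav := norm_avgMid_le (gridError u (k g) (w g)) n
    refine (hKF _ hmid _ _ ?_ ?_).trans (le_of_eq ?_)
    · rw [add_assoc, add_sub_cancel_left]
      linarith [norm_add_le τ (avgMid (gridError u (k g) (w g)) n)]
    · rw [sub_self, norm_zero]
      linarith [norm_nonneg (gridError u (k g) (w g) n)]
    · rw [add_assoc, add_sub_cancel_left]
  -- Substituting `rfl` makes the ambient scalar structure the one induced by the inner product, so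
  -- the energy estimate applies to the same space.
  rcases hcond with ⟨μ, hμ⟩ | ⟨H, rfl, hmon⟩ | ⟨hfin, M, hM⟩ | hconv
  · refine ⟨μ, (μ + 1) * C, k₀, μ.2, by positivity, hk₀, fun g hg n hn hnN => ?_⟩
    obtain ⟨hmid, σ, τ, hσ, hτ, heq⟩ := herr g hg n hn hnN
    rw [mul_assoc ((μ : ℝ) + 1)]
    refine sub_le_of_lipschitz_step (hk g) μ.2 heq ?_ hσ hτ
    refine ((hμ _ hmid).norm_sub_le _ _).trans (le_of_eq ?_)
    rw [add_assoc, add_sub_cancel_left]; rfl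
  · obtain ⟨K, δ, hK, hδ, hKF⟩ := exists_lipschitz_near hF1 huj.continuousOn
    refine ⟨0, (K + 1) * C, min k₀ (δ / (C + 1)), le_rfl, by positivity,
      lt_min hk₀ (by positivity), fun g hg n hn hnN => ?_⟩
    obtain ⟨hg0, hgδ⟩ := hsmall δ hδ g hg
    obtain ⟨hmid, σ, τ, hσ, hτ, heq⟩ := herr g hg0 n hn hnN
    rw [mul_assoc (K + 1), mul_zero, zero_mul, zero_add]
    -- The intermediate point is `u + τ`: it differs from the argument of `F` in the scheme by
    -- exactly `E e`, and from `u` by the small `τ`, which lies within the tube.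
    refine sub_le_of_monotone_step (hk g) heq
      (f₁ := F ((n + 1 / 2) * k g) (u ((n + 1 / 2) * k g) + τ)) ?_ ?_ hσ
    · have := hmon _ hmid (u ((n + 1 / 2) * k g) + τ + avgMid (gridError u (k g) (w g)) n)
        (u ((n + 1 / 2) * k g) + τ)
      rwa [add_sub_cancel_left] at this
    · refine (hKF _ hmid _ _ ?_ ?_).trans ?_
      · rw [add_sub_cancel_left]; exact hτ.trans hgδ
      · rw [sub_self, norm_zero]; exact hδ.le
      · rw [add_sub_cancel_left]; gcongr
  -- The extra radius 1 leaves room for `τ`.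
  · obtain ⟨K, hK, hKF⟩ := exists_lipschitz_of_finiteDimensional hT hF1 huj.continuousOn (M + 1)
    exact hlip ⟨K, M, 1, 1, hK, one_pos, one_pos, hKF, fun g _ => hM g⟩
  · obtain ⟨K, δ, hK, hδ, hKF⟩ := exists_lipschitz_near hF1 huj.continuousOn
    -- Half of the tube radius is reserved for the error and half for `τ`.
    obtain ⟨k₁, hk₁, h⟩ := hconv (δ / 2) (half_pos hδ)
    refine hlip ⟨K, δ / 2, δ / 2, k₁, hK, half_pos hδ, hk₁, ?_, h⟩
    rwa [add_halves]
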